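/- **Setting.** Let $\mathcal N$ be a smooth, connected, Hausdorff, second countable manifold without boundary. Null hypersurface data $\{\mathcal N,\gamma,\boldsymbol\ell,\ell^{(2)},\mathbf Y\}$ consist of a smooth symmetric $(0,2)$-tensor $\gamma$ of signature $(0,+,\dots,+)$, a smooth covector $\boldsymbol\ell$, a smooth function $\ell^{(2)}$ and a smooth symmetric $(0,2)$-tensor $\mathbf Y$, such that $\mathcal A((W,a),(Z,b))=\gamma(W,Z)+a\boldsymbol\ell(Z)+b\boldsymbol\ell(W)+ab\,\ell^{(2)}$ is non-degenerate on every $T_p\mathcal N\times\mathbb R$. Let $n$ be the vector field with $\gamma(n,\cdot)=0$, $\boldsymbol\ell(n)=1$; the generators are the images of its maximal integral curves. Put $\mathbf F=\frac12 d\boldsymbol\ell$, $\boldsymbol s=\mathbf F(n,\cdot)$, $\mathbf U=\frac12\mathcal L_n\gamma$, $\boldsymbol r=\mathbf Y(n,\cdot)$, $\kappa_n=-\mathbf Y(n,n)$, and let $\mathring\nabla$ be the torsion-free connection with $\mathring\nabla_a\gamma_{bc}=-\ell_bU_{ac}-\ell_cU_{ab}$ and $\mathring\nabla_a\ell_b=F_{ab}-\ell^{(2)}U_{ab}$.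 A gauge transformation is given by a nowhere zero smooth function $z$ and a smooth vector field $V$, and maps the data to $\gamma'=\gamma$, $\boldsymbol\ell'=z(\boldsymbol\ell+\gamma(V,\cdot))$, $\ell^{(2)\prime}=z^2(\ell^{(2)}+2\boldsymbol\ell(V)+\gamma(V,V))$, $\mathbf Y'=z\mathbf Y+\frac12(\boldsymbol\ell\otimes dz+dz\otimes\boldsymbol\ell)+\frac12\mathcal L_{zV}\gamma$. Let $\bar\eta$ be a smooth vector field in the radical of $\gamma$, fixed independently of the gauge (gauge-invariant). Write $\bar\eta=\alpha n$, $\mathcal S=\{p:\bar\eta|_p=0\}$, and define its surface gravity $\kappa=d\alpha(n)-\alpha\mathbf Y(n,n)$, which is gauge-invariant. The data with $\bar\eta$ are an abstract Killing horizon of order zero if $\mathcal S$ has empty interior and $\mathcal L_{\bar\eta}\gamma=0$; an abstract weak Killing horizon of order one (AWKH$_1$) if moreover $\alpha\mathcal L_n(\boldsymbol s-\boldsymbol r)+d(n(\alpha))+\kappa_n d\alpha=0$; an abstract Killing horizon of order one (AKH$_1$) if they are of order zero and $$\mathring\nabla_a\mathring\nabla_b\alpha+2(\mathring\nabla_{(a}\alpha)(s_{b)}-r_{b)})+2\alpha\mathring\nabla_{(a}s_{b)}+n(\alpha)Y_{ab}-\alpha\mathcal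 L_nY_{ab}=0 .$$ A transverse submanifold is a codimension-one embedded submanifold of $\mathcal N$ to which $n$ is everywhere transverse. A cross-section is a transverse submanifold which every generator meets precisely once, meaning that each maximal integral curve of $n$ meets it at precisely one value of its parameter. **Theorem 8.3.** Every AKH$_1$ is an AWKH$_1$. Let the data with $\bar\eta$ be an AWKH$_1$. Then $\kappa$ is constant along the generators. Assume moreover that $\mathcal N$ admits a cross-section. Then there is a gauge with $\kappa_n=0$, and in every such gauge the following holds. There is a smooth function $\lambda$ with $n(\lambda)=1$, and for every such $\lambda$ there is a smooth function $f$ with $n(f)=0$, $$\bar\eta=(f+\kappa\lambda)\,n,\qquad \mathcal S=\{p\in\mathcal N: f(p)+\kappa(p)\lambda(p)=0\},$$ such that for every $p\in\mathcal N$ (not necessarily a fixed point): (i) If $\kappa(p)\neq0$, there is an open neighbourhood $\mathcal U_p$ of $p$ on which $\kappa\neq0$, and either $\mathcal S\cap\mathcal U_p=\emptyset$ or $\mathcal S\cap\mathcal U_p$ is a (connected) transverse submanifold of $\mathcal N$. (ii) If $\kappa(p)=0$, then on the generator through $p$ the field $\bar\eta$ either vanishes identically or vanishes nowhere. (iii)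 If the data with $\bar\eta$ are an AKH$_1$, then $\mathcal S=\mathcal S_1\cup\mathcal S_2$, where $\mathcal S_1=\{f=0\}\cap\{\kappa=0\}$ is a (possibly empty) union of generators, and $\mathcal S_2$ is a (possibly empty) union of transverse submanifolds of $\mathcal N$; more precisely, $\mathcal S_2$ is itself a, possibly empty or disconnected, transverse submanifold, and so is each of its connected components. Moreover $\kappa$ vanishes identically on $\mathcal S_1$ and nowhere on $\mathcal S_2$. -/

import Mathlib

open scoped Manifold ContDiff Topology Bundle

noncomputable section

namespace NullHorizon

section Basic

variable {d : ℕ} {N : Type*} [TopologicalSpace N] [ChartedSpace (EuclideanSpace ℝ (Fin d)) N]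
  [IsManifold (𝓡 d) ∞ N]

variable (d N) in
/-- (Not necessarily continuous) vector fields on the `d`-dimensional manifold `N`. -/
abbrev VField : Type _ := ∀ p : N, TangentSpace (𝓡 d) p

/-- Smoothness of a vector field. -/
def IsSmoothField (X : VField d N) : Prop :=
  ContMDiff (𝓡 d) (𝓡 d).tangent ∞ (fun p => (⟨p, X p⟩ : TangentBundle (𝓡 d) N))

/-- Smoothness of a real function, i.e. membership in `F(N)`. -/
def IsSmoothFun (f : N → ℝ) : Prop := ContMDiff (𝓡 d) 𝓘(ℝ, ℝ) ∞ f

/-- The derivative `X(f) = df(X)` of a function along a vector field. -/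
def dir (X : VField d N) (f : N → ℝ) : N → ℝ := fun p => mvfderiv (𝓡 d) f p (X p)

/-- The Lie bracket `[X, W]`. -/
def bracket (X W : VField d N) : VField d N := fun p => VectorField.mlieBracket (𝓡 d) X W p

/-- The Lie derivative along `X` of a covector `θ`, evaluated on a vector field:
`(£_X θ)(W) = X(θ(W)) - θ([X, W])`.  The covector is given through its action on vector fields. -/
def lieCovector (X : VField d N) (θ : VField d N → N → ℝ) (W : VField d N) : N → ℝ :=
  fun p => dir X (θ W) p - θ (bracket X W) p

/-- The Lie derivative along `X` of a `(0,2)`-tensor `T`, evaluated on vector fields: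
`(£_X T)(W, Z) = X(T(W, Z)) - T([X, W], Z) - T(W, [X, Z])`. -/
def lieBilin (X : VField d N)
    (T : ∀ p : N, TangentSpace (𝓡 d) p →L[ℝ] TangentSpace (𝓡 d) p →L[ℝ] ℝ)
    (W Z : VField d N) : N → ℝ :=
  fun p => dir X (fun q => T q (W q) (Z q)) p
    - T p (bracket X W p) (Z p) - T p (W p) (bracket X Z p)

/-- `FlowsTo X p t q`: the integral curve of `X` starting at `p` is defined up to the parameter
value `t`, where it takes the value `q`. -/
def FlowsTo (X : VField d N) (p : N) (t : ℝ) (q : N) : Prop :=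
  ∃ (c : ℝ → N) (a b : ℝ), 0 ∈ Set.Ioo a b ∧ t ∈ Set.Ioo a b ∧
    IsMIntegralCurveOn (I := 𝓡 d) c X (Set.Ioo a b) ∧ c 0 = p ∧ c t = q

end Basic

/-- Null metric hypersurface data `{N, γ, ℓ, ℓ⁽²⁾}` on the `d`-dimensional manifold `N`. -/
structure NullMetricData (d : ℕ) (N : Type*) [TopologicalSpace N]
    [ChartedSpace (EuclideanSpace ℝ (Fin d)) N] [IsManifold (𝓡 d) ∞ N] where
  /-- the tensor `γ` -/
  gamma : ∀ p : N, TangentSpace (𝓡 d) p →L[ℝ] TangentSpace (𝓡 d) p →L[ℝ] ℝ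
  /-- the covector `ℓ` -/
  ell : ∀ p : N, TangentSpace (𝓡 d) p →L[ℝ] ℝ
  /-- the scalar `ℓ⁽²⁾` -/
  ell2 : N → ℝ
  gamma_smooth : ContMDiff (𝓡 d)
    ((𝓡 d).prod 𝓘(ℝ, EuclideanSpace ℝ (Fin d) →L[ℝ] EuclideanSpace ℝ (Fin d) →L[ℝ] ℝ)) ∞
    (fun p => Bundle.TotalSpace.mk'
      (EuclideanSpace ℝ (Fin d) →L[ℝ] EuclideanSpace ℝ (Fin d) →L[ℝ] ℝ)
      (E := fun p : N => TangentSpace (𝓡 d) p →L[ℝ] TangentSpace (𝓡 d) p →L[ℝ] ℝ)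
      p (gamma p))
  ell_smooth : ContMDiff (𝓡 d) ((𝓡 d).prod 𝓘(ℝ, EuclideanSpace ℝ (Fin d) →L[ℝ] ℝ)) ∞
    (fun p => Bundle.TotalSpace.mk' (EuclideanSpace ℝ (Fin d) →L[ℝ] ℝ)
      (E := fun p : N => TangentSpace (𝓡 d) p →L[ℝ] ℝ) p (ell p))
  ell2_smooth : ContMDiff (𝓡 d) 𝓘(ℝ, ℝ) ∞ ell2
  gamma_symm : ∀ p v w, gamma p v w = gamma p w v
  /-- Together with the next field: `γ` has signature `(0, +, ..., +)`, i.e. it is positive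
  semi-definite with one-dimensional radical. -/
  gamma_nonneg : ∀ p v, 0 ≤ gamma p v v
  gamma_radical : ∀ p, Module.finrank ℝ (LinearMap.ker (gamma p).toLinearMap) = 1
  /-- The tensor `A((W,a),(Z,b)) = γ(W,Z) + a ℓ(Z) + b ℓ(W) + a b ℓ⁽²⁾` is non-degenerate. -/
  nondeg : ∀ (p : N) (W : TangentSpace (𝓡 d) p) (a : ℝ),
    (∀ (Z : TangentSpace (𝓡 d) p) (b : ℝ),
      gamma p W Z + a * ell p Z + b * ell p W + a * b * ell2 p = 0) → W = 0 ∧ a = 0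

/-- Null hypersurface data `{N, γ, ℓ, ℓ⁽²⁾, Y}`. -/
structure NullData (d : ℕ) (N : Type*) [TopologicalSpace N]
    [ChartedSpace (EuclideanSpace ℝ (Fin d)) N] [IsManifold (𝓡 d) ∞ N]
    extends NullMetricData d N where
  /-- the tensor `Y` -/
  Y : ∀ p : N, TangentSpace (𝓡 d) p →L[ℝ] TangentSpace (𝓡 d) p →L[ℝ] ℝ
  Y_smooth : ContMDiff (𝓡 d)
    ((𝓡 d).prod 𝓘(ℝ, EuclideanSpace ℝ (Fin d) →L[ℝ] EuclideanSpace ℝ (Fin d) →L[ℝ] ℝ)) ∞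
    (fun p => Bundle.TotalSpace.mk'
      (EuclideanSpace ℝ (Fin d) →L[ℝ] EuclideanSpace ℝ (Fin d) →L[ℝ] ℝ)
      (E := fun p : N => TangentSpace (𝓡 d) p →L[ℝ] TangentSpace (𝓡 d) p →L[ℝ] ℝ)
      p (Y p))
  Y_symm : ∀ p v w, Y p v w = Y p w v

section Metric

variable {d : ℕ} {N : Type*} [TopologicalSpace N] [ChartedSpace (EuclideanSpace ℝ (Fin d)) N]
  [IsManifold (𝓡 d) ∞ N]

namespace NullMetricData

variable (D : NullMetricData d N)

/-- The tensor `A` on `T_pN × ℝ`. -/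
def amb (p : N) (x y : TangentSpace (𝓡 d) p × ℝ) : ℝ :=
  D.gamma p x.1 y.1 + x.2 * D.ell p y.1 + y.2 * D.ell p x.1 + x.2 * y.2 * D.ell2 p

theorem exists_n (p : N) : ∃ v : TangentSpace (𝓡 d) p,
    ∀ y : TangentSpace (𝓡 d) p × ℝ, D.amb p (v, 0) y = y.2 := by
  obtain ⟨⟨v, hv⟩, hv0, -⟩ := finrank_eq_one_iff'.mp (D.gamma_radical p)
  have hk : D.gamma p v = 0 := by simpa using hv
  have hl : D.ell p v ≠ 0 := by
    intro h0
    have h1 := (D.nondeg p v 0 (fun Z b => by rw [hk, h0]; simp)).1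
    exact hv0 (Subtype.ext h1)
  refine ⟨(D.ell p v)⁻¹ • v, fun y => ?_⟩
  simp [amb, hk, hl]

/-- The vector field `n`: the element `(n, 0)` of `T_pN × ℝ` that the inverse of `A` associates
with the covector `(0, 1)`, i.e. the vector appearing in the splitting
`A♯((α,a),(β,b)) = P(α,β) + a n(β) + b n(α)`. -/
def n : VField d N := fun p => (D.exists_n p).choose

theorem n_spec (p : N) (y : TangentSpace (𝓡 d) p × ℝ) : D.amb p (D.n p, 0) y = y.2 :=
  (D.exists_n p).choose_spec y

theorem gamma_n (p : N) : D.gamma p (D.n p) = 0 := by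
  ext Z
  simpa [amb] using D.n_spec p (Z, 0)

theorem ell_n (p : N) : D.ell p (D.n p) = 1 := by
  simpa [amb] using D.n_spec p (0, 1)

/-- `ℓ` as an operation on vector fields. -/
def ellField (W : VField d N) : N → ℝ := fun p => D.ell p (W p)

/-- `F = ½ dℓ`, evaluated on vector fields. -/
def F (X W : VField d N) : N → ℝ := fun p =>
  (1 / 2) * (dir X (D.ellField W) p - dir W (D.ellField X) p - D.ellField (bracket X W) p)

/-- `s = F(n, ·)`. -/
def s (W : VField d N) : N → ℝ := D.F D.n W

/-- `U = ½ £_n γ`, evaluated on vector fields. -/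
def U (X W : VField d N) : N → ℝ := fun p => (1 / 2) * lieBilin D.n D.gamma X W p

/-- The generator through `p`: the image of the maximal integral curve of `n` through `p`. -/
def generator (p : N) : Set N := {q | ∃ t : ℝ, FlowsTo D.n p t q}

/-- `S` is a transverse submanifold: a codimension-one embedded submanifold of `N`
(around each of its points it is, in some chart `φ` of the smooth structure, the slice of a linear
hyperplane `H`, so that `T_pS = {v | dφ_p(v) ∈ H}`) to which `n` is everywhere transverse.
The set is allowed to be empty or disconnected. -/
def IsTransverseSubmanifold (S : Set N) : Prop :=
  ∀ p ∈ S, ∃ φ ∈ IsManifold.maximalAtlas (𝓡 d) ∞ N, p ∈ φ.source ∧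
    ∃ H : Submodule ℝ (EuclideanSpace ℝ (Fin d)), Module.finrank ℝ H + 1 = d ∧
      (∀ q ∈ φ.source, q ∈ S ↔ φ q ∈ H) ∧
      mfderiv (𝓡 d) (𝓡 d) φ p (D.n p) ∉ H

/-- `S` is a cross-section: a transverse submanifold which every generator meets precisely once,
i.e. the maximal integral curve of `n` through any point meets `S` at precisely one value of its
parameter. -/
def IsCrossSection (S : Set N) : Prop :=
  D.IsTransverseSubmanifold S ∧ ∀ p : N, ∃! t : ℝ, ∃ q ∈ S, FlowsTo D.n p t q

/-- `nab` is the metric hypersurface connection of the data: the torsion-free connection with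
`(∇_X γ)(W,Z) = - ℓ(W) U(X,Z) - ℓ(Z) U(X,W)` and `(∇_X ℓ)(W) = F(X,W) - ℓ⁽²⁾ U(X,W)`.
In Mathlib's convention `nab W p (X p)` is `∇_X W` at `p`. -/
structure IsMetricConnection
    (nab : CovariantDerivative (𝓡 d) (EuclideanSpace ℝ (Fin d))
      (TangentSpace (𝓡 d) : N → Type _)) : Prop where
  smooth : ∀ X W : VField d N, IsSmoothField X → IsSmoothField W →
    IsSmoothField (fun p => nab W p (X p))
  torsion_free : ∀ X W : VField d N, IsSmoothField X → IsSmoothField W → ∀ p,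
    nab W p (X p) - nab X p (W p) = bracket X W p
  nabla_gamma : ∀ X W Z : VField d N, IsSmoothField X → IsSmoothField W → IsSmoothField Z → ∀ p,
    dir X (fun q => D.gamma q (W q) (Z q)) p
        - D.gamma p (nab W p (X p)) (Z p) - D.gamma p (W p) (nab Z p (X p))
      = - D.ell p (W p) * D.U X Z p - D.ell p (Z p) * D.U X W p
  nabla_ell : ∀ X W : VField d N, IsSmoothField X → IsSmoothField W → ∀ p,
    dir X (D.ellField W) p - D.ell p (nab W p (X p)) = D.F X W p - D.ell2 p * D.U X W p

end NullMetricData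

namespace NullData

variable (D : NullData d N)

/-- `r = Y(n, ·)`. -/
def r (W : VField d N) : N → ℝ := fun p => D.Y p (D.n p) (W p)

/-- `κ_n = -Y(n, n)`. -/
def kappaN : N → ℝ := fun p => - D.Y p (D.n p) (D.n p)

/-- `D'` is the gauge transform `G_(z,V)(D)`. -/
structure IsGaugeTransform (D D' : NullData d N) (z : N → ℝ) (V : VField d N) : Prop where
  z_smooth : IsSmoothFun (d := d) z
  z_ne : ∀ p, z p ≠ 0
  V_smooth : IsSmoothField V
  gamma_eq : ∀ p, D'.gamma p = D.gamma p
  ell_eq : ∀ p v, D'.ell p v = z p * (D.ell p v + D.gamma p (V p) v)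
  ell2_eq : ∀ p, D'.ell2 p =
    z p ^ 2 * (D.ell2 p + 2 * D.ell p (V p) + D.gamma p (V p) (V p))
  Y_eq : ∀ X W : VField d N, IsSmoothField X → IsSmoothField W → ∀ p,
    D'.Y p (X p) (W p) = z p * D.Y p (X p) (W p)
      + (1 / 2) * (D.ell p (X p) * dir W z p + D.ell p (W p) * dir X z p)
      + (1 / 2) * lieBilin (fun q => z q • V q) D.gamma X W p

variable (η : VField d N)

/-- The function `α` with `η = α n`, for `η` in the radical of `γ`; as `ℓ(n) = 1`,
it equals `ℓ(η)`. -/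
def alpha : N → ℝ := fun p => D.ell p (η p)

theorem eq_alpha_smul_n (hη : ∀ p, D.gamma p (η p) = 0) (p : N) :
    η p = D.alpha η p • D.n p := by
  have h := (D.nondeg p (η p - D.alpha η p • D.n p) 0 (fun Z b => by
    simp [hη p, D.gamma_n p, D.ell_n p, alpha])).1
  exact sub_eq_zero.mp h

/-- The surface gravity `κ = dα(n) - α Y(n, n)` of `η = α n`. -/
def kappa : N → ℝ := fun p =>
  dir D.n (D.alpha η) p - D.alpha η p * D.Y p (D.n p) (D.n p)

/-- The fixed points set. -/
def fixedSet (η : VField d N) : Set N := {p | η p = 0}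

/-- The data with the vector field `η` form an abstract Killing horizon of order zero.  The field
`η` is given independently of the gauge. -/
structure IsAKH0 : Prop where
  smooth : IsSmoothField η
  mem_rad : ∀ p, D.gamma p (η p) = 0
  interior_fixed : interior (fixedSet η) = ∅
  lie_gamma : ∀ X W : VField d N, IsSmoothField X → IsSmoothField W → ∀ p,
    lieBilin η D.gamma X W p = 0

/-- Abstract weak Killing horizon of order one:
`0 = α £_n(s - r) + d(n(α)) + κ_n dα`. -/
structure IsAWKH1 : Prop extends D.IsAKH0 η where
  weak_eq : ∀ W : VField d N, IsSmoothField W → ∀ p,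
    D.alpha η p * lieCovector D.n (fun Z q => D.s Z q - D.r Z q) W p
      + dir W (dir D.n (D.alpha η)) p + D.kappaN p * dir W (D.alpha η) p = 0

/-- Abstract Killing horizon of order one:
`0 = ∇_a∇_b α + 2 (∇_(a α)(s_b) - r_b)) + 2 α ∇_(a s_b) + n(α) Y_ab - α £_n Y_ab`,
where `∇` is the metric hypersurface connection; the equation is evaluated on two arbitrary
vector fields. -/
structure IsAKH1 : Prop extends D.IsAKH0 η where
  order_one_eq : ∃ nab : CovariantDerivative (𝓡 d) (EuclideanSpace ℝ (Fin d))
      (TangentSpace (𝓡 d) : N → Type _), D.IsMetricConnection nab ∧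
    ∀ X W : VField d N, IsSmoothField X → IsSmoothField W → ∀ p,
      (dir X (dir W (D.alpha η)) p - dir (fun q => nab W q (X q)) (D.alpha η) p)
        + (dir X (D.alpha η) p * (D.s W p - D.r W p)
          + dir W (D.alpha η) p * (D.s X p - D.r X p))
        + D.alpha η p * ((dir X (D.s W) p - D.s (fun q => nab W q (X q)) p)
          + (dir W (D.s X) p - D.s (fun q => nab X q (W q)) p))
        + dir D.n (D.alpha η) p * D.Y p (X p) (W p)
        - D.alpha η p * lieBilin D.n D.Y X W p = 0

end NullData

end Metric

end NullHorizon

end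

/-! Everything reduces to one ordinary differential equation along the generators. Since `α U = 0`
and `α ≠ 0` on a dense set, continuity gives `U = 0`. Then `∇_W n = s(W) n`, and contracting the
order-one equation once with `n` leaves exactly the weak equation (`IsAKH1.isAWKH1`). Contracting
that with `n` again, with `(s - r)(n) = κ_n`, gives `n(κ) = 0` for `κ = n(α) + α κ_n`
(`IsAWKH1.dir_n_kappa`).

Under a gauge change `κ_n` becomes `z⁻¹ (κ_n - z⁻¹ n(z))`, so `z = exp u` with `n(u) = κ_n` removes
it. In any gauge with `κ_n = 0` the equation reads `n(α) = κ`, `n(κ) = 0`, hence `f = α - κ λ` is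
constant along the generators. Where `κ ≠ 0`, `α` has nonzero derivative along `n` and its zero set
is a transverse hypersurface (`exists_adapted_chart`); where `κ = 0`, `α = f` is constant on the
whole generator.

The analytic work lies in the global smooth solution of `n(u) = g`
(`IsCrossSection.exists_dir_n_eq`). One integrates `g` along each generator from the cross-section.
A flow box at the cross-section makes the result smooth there, and overlapping flow boxes carry
smoothness along each generator. Flow boxes need a flow smooth in time and initial point
(`exists_local_flow`), which comes from the inverse function theorem in a Banach space of continuous
curves. -/

noncomputable section

namespace NullHorizon

open VectorField Bundle

set_option linter.unusedSectionVars false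

/-! ### Calculus of smooth functions, vector fields and brackets -/

section FieldCalculus

variable {d : ℕ} {N : Type*} [TopologicalSpace N] [ChartedSpace (EuclideanSpace ℝ (Fin d)) N]
  [IsManifold (𝓡 d) ∞ N]

local notation "𝔼" => EuclideanSpace ℝ (Fin d)

theorem IsSmoothFun.mdifferentiableAt {f : N → ℝ} (hf : IsSmoothFun (d := d) f) (p : N) :
    MDifferentiableAt (𝓡 d) 𝓘(ℝ, ℝ) f p :=
  ContMDiff.mdifferentiable hf (by simp) p

theorem IsSmoothField.mdifferentiableAt {X : VField d N} (hX : IsSmoothField X) (p : N) :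
    MDifferentiableAt (𝓡 d) (𝓡 d).tangent
      (fun p => (⟨p, X p⟩ : TangentBundle (𝓡 d) N)) p :=
  ContMDiff.mdifferentiable hX (by simp) p

theorem IsSmoothField.smul {f : N → ℝ} {W : VField d N} (hf : IsSmoothFun (d := d) f)
    (hW : IsSmoothField W) : IsSmoothField (fun p => f p • W p) :=
  ContMDiff.smul_section hf hW

theorem IsSmoothField.bracket {X W : VField d N} (hX : IsSmoothField X) (hW : IsSmoothField W) :
    IsSmoothField (NullHorizon.bracket X W) := by
  have : IsManifold (𝓡 d) (((⊤ : ℕ∞) : WithTop ℕ∞) + 1) N :=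
    inferInstanceAs (IsManifold (𝓡 d) ∞ N)
  have : IsManifold (𝓡 d) (minSmoothness ℝ 2) N := by
    rw [minSmoothness_of_isRCLikeNormedField]
    exact IsManifold.of_le (n := ∞) ENat.LEInfty.out
  exact ContDiff.mlieBracket_vectorField (m := ⊤) (n := ⊤) (I := 𝓡 d) hX hW (by simp)

theorem IsSmoothFun.dir {X : VField d N} {f : N → ℝ} (hX : IsSmoothField X)
    (hf : IsSmoothFun (d := d) f) : IsSmoothFun (d := d) (NullHorizon.dir X f) := by
  have h := (contMDiff_snd_tangentBundle_modelSpace ℝ 𝓘(ℝ, ℝ) (n := ∞)).comp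
    ((ContMDiff.contMDiff_tangentMap hf (m := ∞) (by simp)).comp hX)
  exact h

theorem dir_add {X : VField d N} {f g : N → ℝ} (hf : IsSmoothFun (d := d) f)
    (hg : IsSmoothFun (d := d) g) (p : N) :
    dir X (fun q => f q + g q) p = dir X f p + dir X g p := by
  have := mvfderiv_add (hf.mdifferentiableAt p) (hg.mdifferentiableAt p)
  exact congrArg (fun L => L (X p)) this

theorem dir_sub {X : VField d N} {f g : N → ℝ} (hf : IsSmoothFun (d := d) f)
    (hg : IsSmoothFun (d := d) g) (p : N) :
    dir X (fun q => f q - g q) p = dir X f p - dir X g p := by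
  have := mvfderiv_sub (hf.mdifferentiableAt p) (hg.mdifferentiableAt p)
  exact congrArg (fun L => L (X p)) this

theorem dir_mul {X : VField d N} {f g : N → ℝ} (hf : IsSmoothFun (d := d) f)
    (hg : IsSmoothFun (d := d) g) (p : N) :
    dir X (fun q => f q * g q) p = f p * dir X g p + g p * dir X f p := by
  have := mvfderiv_mul (hf.mdifferentiableAt p) (hg.mdifferentiableAt p)
  exact congrArg (fun L => L (X p)) this

theorem dir_const (X : VField d N) (c : ℝ) (p : N) : dir X (fun _ => c) p = 0 := by
  simp [dir, mvfderiv_const]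

theorem dir_add_left (X W : VField d N) (f : N → ℝ) (p : N) :
    dir (fun q => X q + W q) f p = dir X f p + dir W f p := by
  simp [dir]

theorem dir_smul_left (h : N → ℝ) (X : VField d N) (f : N → ℝ) (p : N) :
    dir (fun q => h q • X q) f p = h p * dir X f p := by
  simp [dir]

theorem bracket_self (X : VField d N) (p : N) : bracket X X p = 0 := by
  simp [bracket]

theorem bracket_swap (X W : VField d N) (p : N) : bracket X W p = - bracket W X p :=
  mlieBracket_swap_apply

theorem bracket_add_right {X W Z : VField d N} (hW : IsSmoothField W) (hZ : IsSmoothField Z)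
    (p : N) : bracket X (fun q => W q + Z q) p = bracket X W p + bracket X Z p :=
  mlieBracket_add_right (hW.mdifferentiableAt p) (hZ.mdifferentiableAt p)

theorem bracket_smul_right {X W : VField d N} {f : N → ℝ} (hf : IsSmoothFun (d := d) f)
    (hW : IsSmoothField W) (p : N) :
    bracket X (fun q => f q • W q) p = dir X f p • W p + f p • bracket X W p :=
  mlieBracket_smul_right (hf.mdifferentiableAt p) (hW.mdifferentiableAt p)

theorem bracket_smul_left {X W : VField d N} {f : N → ℝ} (hf : IsSmoothFun (d := d) f)
    (hX : IsSmoothField X) (p : N) :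
    bracket (fun q => f q • X q) W p = - (dir W f p • X p) + f p • bracket X W p := by
  rw [bracket_swap, bracket_smul_right hf hX, bracket_swap W X]
  simp; abel

theorem jacobi {X W Z : VField d N} (hX : IsSmoothField X) (hW : IsSmoothField W)
    (hZ : IsSmoothField Z) (p : N) :
    bracket X (bracket W Z) p = bracket (bracket X W) Z p + bracket W (bracket X Z) p := by
  have hle : minSmoothness ℝ 2 ≤ (∞ : WithTop ℕ∞) := by
    rw [minSmoothness_of_isRCLikeNormedField]
    exact ENat.LEInfty.out
  have : IsManifold (𝓡 d) (minSmoothness ℝ 3) N := by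
    rw [minSmoothness_of_isRCLikeNormedField]
    exact IsManifold.of_le (n := ∞) ENat.LEInfty.out
  exact leibniz_identity_mlieBracket_apply ((hX p).of_le hle) ((hW p).of_le hle)
    ((hZ p).of_le hle)

/-- The commutator formula `[X, W](f) = X(W(f)) - W(X(f))`, on a manifold with a nowhere vanishing
smooth field. -/
theorem dir_bracket {X W Z : VField d N} {f : N → ℝ} (hX : IsSmoothField X)
    (hW : IsSmoothField W) (hZ : IsSmoothField Z) (hf : IsSmoothFun (d := d) f) {p : N}
    (hp : Z p ≠ 0) : dir (bracket X W) f p = dir X (dir W f) p - dir W (dir X f) p := by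
  -- The Leibniz rule turns the Jacobi identity for `X`, `W`, `f Z` into the commutator formula:
  -- after removing `f` times the Jacobi identity for `Z` and the mixed terms, only a multiple of
  -- `Z` remains.
  have key {X W : VField d N} (hX : IsSmoothField X) (hW : IsSmoothField W) :
      bracket X (bracket W (fun q => f q • Z q)) p =
        dir X (dir W f) p • Z p + dir W f p • bracket X Z p +
          (dir X f p • bracket W Z p + f p • bracket X (bracket W Z) p) := by
    have : bracket W (fun q => f q • Z q) = fun q => dir W f q • Z q + f q • bracket W Z q :=
      funext fun q => bracket_smul_right hf hZ q
    rw [this, bracket_add_right (IsSmoothField.smul (hf.dir hW) hZ)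
      (IsSmoothField.smul hf (hW.bracket hZ)),
      bracket_smul_right (hf.dir hW) hZ, bracket_smul_right hf (hW.bracket hZ)]
  have h1 := jacobi hX hW (IsSmoothField.smul hf hZ) p
  rw [key hX hW, key hW hX, bracket_smul_right hf hZ, jacobi hX hW hZ] at h1
  have h2 : (dir (bracket X W) f p - (dir X (dir W f) p - dir W (dir X f) p)) • Z p = 0 := by
    simp only [sub_smul]
    simp only [smul_add] at h1
    rw [← sub_eq_zero] at h1
    rw [← neg_eq_zero, ← h1]
    abel
  exact sub_eq_zero.mp ((smul_eq_zero.mp h2).resolve_right hp)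

theorem IsSmoothFun.mul {f g : N → ℝ} (hf : IsSmoothFun (d := d) f)
    (hg : IsSmoothFun (d := d) g) : IsSmoothFun (d := d) (fun p => f p * g p) :=
  ContMDiff.mul hf hg

theorem IsSmoothFun.add {f g : N → ℝ} (hf : IsSmoothFun (d := d) f)
    (hg : IsSmoothFun (d := d) g) : IsSmoothFun (d := d) (fun p => f p + g p) :=
  ContMDiff.add hf hg

theorem IsSmoothFun.sub {f g : N → ℝ} (hf : IsSmoothFun (d := d) f)
    (hg : IsSmoothFun (d := d) g) : IsSmoothFun (d := d) (fun p => f p - g p) :=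
  ContMDiff.sub hf hg

theorem IsSmoothFun.neg {f : N → ℝ} (hf : IsSmoothFun (d := d) f) :
    IsSmoothFun (d := d) (fun p => - f p) :=
  ContMDiff.neg hf

end FieldCalculus

/-! ### Smoothness of tensors evaluated on fields -/

section Tensors

variable {d : ℕ} {N : Type*} [TopologicalSpace N] [ChartedSpace (EuclideanSpace ℝ (Fin d)) N]
  [IsManifold (𝓡 d) ∞ N]

local notation "𝔼" => EuclideanSpace ℝ (Fin d)

theorem contMDiffAt_covector_apply
    {θ : ∀ p : N, TangentSpace (𝓡 d) p →L[ℝ] ℝ} {X : VField d N} {p : N}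
    (hθ : ContMDiffAt (𝓡 d) ((𝓡 d).prod 𝓘(ℝ, 𝔼 →L[ℝ] ℝ)) ∞
      (fun p => TotalSpace.mk' (𝔼 →L[ℝ] ℝ) (E := fun p : N => TangentSpace (𝓡 d) p →L[ℝ] ℝ)
        p (θ p)) p)
    (hX : ContMDiffAt (𝓡 d) (𝓡 d).tangent ∞
      (fun p => (⟨p, X p⟩ : TangentBundle (𝓡 d) N)) p) :
    ContMDiffAt (𝓡 d) 𝓘(ℝ, ℝ) ∞ (fun p => θ p (X p)) p := by
  have h := ContMDiffAt.clm_bundle_apply (F₁ := 𝔼) (F₂ := ℝ) (IM := 𝓡 d) (IB := 𝓡 d)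
    (E₁ := fun p : N => TangentSpace (𝓡 d) p) (E₂ := Bundle.Trivial N ℝ) (b := fun p => p)
    (ϕ := θ) (v := X) hθ hX
  exact (contMDiffAt_totalSpace.mp h).2

theorem contMDiffAt_bilin_apply
    {T : ∀ p : N, TangentSpace (𝓡 d) p →L[ℝ] TangentSpace (𝓡 d) p →L[ℝ] ℝ} {X W : VField d N}
    {p : N}
    (hT : ContMDiffAt (𝓡 d) ((𝓡 d).prod 𝓘(ℝ, 𝔼 →L[ℝ] 𝔼 →L[ℝ] ℝ)) ∞
      (fun p => TotalSpace.mk' (𝔼 →L[ℝ] 𝔼 →L[ℝ] ℝ)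
        (E := fun p : N => TangentSpace (𝓡 d) p →L[ℝ] TangentSpace (𝓡 d) p →L[ℝ] ℝ) p (T p)) p)
    (hX : ContMDiffAt (𝓡 d) (𝓡 d).tangent ∞
      (fun p => (⟨p, X p⟩ : TangentBundle (𝓡 d) N)) p)
    (hW : ContMDiffAt (𝓡 d) (𝓡 d).tangent ∞
      (fun p => (⟨p, W p⟩ : TangentBundle (𝓡 d) N)) p) :
    ContMDiffAt (𝓡 d) 𝓘(ℝ, ℝ) ∞ (fun p => T p (X p) (W p)) p := by
  have h := ContMDiffAt.clm_bundle_apply₂ (F₁ := 𝔼) (F₂ := 𝔼) (F₃ := ℝ) (IM := 𝓡 d) (IB := 𝓡 d)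
    (E₁ := fun p : N => TangentSpace (𝓡 d) p) (E₂ := fun p : N => TangentSpace (𝓡 d) p)
    (E₃ := Bundle.Trivial N ℝ) (b := fun p => p) (ψ := T) (v := X) (w := W) hT hX hW
  exact (contMDiffAt_totalSpace.mp h).2

end Tensors

end NullHorizon

namespace NullHorizon

open VectorField Bundle

set_option linter.unusedSectionVars false

/-! ### Smoothness of tensors recovered from their values -/

section HomSections

variable {d : ℕ} {N : Type*} [TopologicalSpace N] [ChartedSpace (EuclideanSpace ℝ (Fin d)) N]
  [IsManifold (𝓡 d) ∞ N]

local notation "𝔼" => EuclideanSpace ℝ (Fin d)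

/-- In finite dimension `f = ∑ cᵢ ⊗ f(bᵢ)` for a basis `bᵢ` with coordinates `cᵢ`, a finite sum of
smooth terms. -/
theorem contMDiffAt_clm_of_apply {F : Type*} [NormedAddCommGroup F] [NormedSpace ℝ F]
    {f : N → 𝔼 →L[ℝ] F} {p : N}
    (h : ∀ v, ContMDiffAt (𝓡 d) 𝓘(ℝ, F) ∞ (fun x => f x v) p) :
    ContMDiffAt (𝓡 d) 𝓘(ℝ, 𝔼 →L[ℝ] F) ∞ f p := by
  let b := (EuclideanSpace.basisFun (Fin d) ℝ).toBasis
  let c : Fin d → (𝔼 →L[ℝ] ℝ) := fun i => LinearMap.toContinuousLinearMap (b.coord i)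
  have hf : f = fun x => ∑ i, ContinuousLinearMap.smulRightL ℝ 𝔼 F (c i) (f x (b i)) := by
    funext x
    refine ContinuousLinearMap.ext fun v => ?_
    conv_lhs => rw [← b.sum_repr v]
    rw [map_sum]
    simp [c]
  rw [hf]
  refine ContMDiffAt.sum fun i _ => ?_
  exact (ContinuousLinearMap.contMDiff _).contMDiffAt.comp p (h (b i))

/-- A section of a bundle of homomorphisms out of the tangent bundle is smooth at a point if it
maps all fields which are smooth there to smooth sections. -/
theorem contMDiffAt_hom_of_apply {F₂ : Type*} [NormedAddCommGroup F₂] [NormedSpace ℝ F₂]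
    {E₂ : N → Type*} [∀ x, AddCommGroup (E₂ x)] [∀ x, Module ℝ (E₂ x)]
    [TopologicalSpace (TotalSpace F₂ E₂)] [∀ x, TopologicalSpace (E₂ x)]
    [FiberBundle F₂ E₂] [VectorBundle ℝ F₂ E₂]
    [∀ x, IsTopologicalAddGroup (E₂ x)] [∀ x, ContinuousSMul ℝ (E₂ x)]
    {T : ∀ p : N, TangentSpace (𝓡 d) p →L[ℝ] E₂ p} {p : N}
    (h : ∀ X : VField d N, ContMDiffAt (𝓡 d) (𝓡 d).tangent ∞
        (fun q => (⟨q, X q⟩ : TangentBundle (𝓡 d) N)) p →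
      ContMDiffAt (𝓡 d) ((𝓡 d).prod 𝓘(ℝ, F₂)) ∞
        (fun q => TotalSpace.mk' F₂ q (T q (X q))) p) :
    ContMDiffAt (𝓡 d) ((𝓡 d).prod 𝓘(ℝ, 𝔼 →L[ℝ] F₂)) ∞
      (fun q => TotalSpace.mk' (𝔼 →L[ℝ] F₂) (E := fun p : N => TangentSpace (𝓡 d) p →L[ℝ] E₂ p)
        q (T q)) p := by
  rw [contMDiffAt_hom_bundle]
  refine ⟨contMDiffAt_id, contMDiffAt_clm_of_apply fun v => ?_⟩
  let e := trivializationAt 𝔼 (TangentSpace (𝓡 d) : N → Type _) p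
  have he : p ∈ e.baseSet := FiberBundle.mem_baseSet_trivializationAt' p
  have he₂ : p ∈ (trivializationAt F₂ E₂ p).baseSet := FiberBundle.mem_baseSet_trivializationAt' p
  -- The test fields are constant in a local trivialization. They are smooth near `p` only, which is
  -- why the hypothesis quantifies over fields smooth at the point.
  have hX : ContMDiffAt (𝓡 d) (𝓡 d).tangent ∞
      (fun q => (⟨q, e.symmL ℝ q v⟩ : TangentBundle (𝓡 d) N)) p := by
    have h1 := e.contMDiffAt_symmL (n := ∞) (IB := 𝓡 d) he
    exact ContMDiffAt.clm_bundle_apply (F₁ := 𝔼) (F₂ := 𝔼) (IM := 𝓡 d) (IB := 𝓡 d)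
      (E₁ := Bundle.Trivial N 𝔼) (E₂ := fun p : N => TangentSpace (𝓡 d) p) (b := fun p => p)
      (ϕ := fun q => e.symmL ℝ q) (v := fun _ => v) h1
      (contMDiffAt_totalSpace.mpr ⟨contMDiffAt_id, contMDiffAt_const⟩)
  refine ((contMDiffAt_totalSpace.mp (h _ hX)).2).congr_of_eventuallyEq ?_
  filter_upwards [e.open_baseSet.mem_nhds he,
    (trivializationAt F₂ E₂ p).open_baseSet.mem_nhds he₂] with q hq hq₂
  rw [ContinuousLinearMap.inCoordinates_eq hq hq₂]
  have := e.symmL_apply (R := ℝ) hq v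
  simp only [e] at this
  simp [e, this]

theorem contMDiffAt_covector_of_apply
    {θ : ∀ p : N, TangentSpace (𝓡 d) p →L[ℝ] ℝ} {p : N}
    (h : ∀ X : VField d N, ContMDiffAt (𝓡 d) (𝓡 d).tangent ∞
        (fun q => (⟨q, X q⟩ : TangentBundle (𝓡 d) N)) p →
      ContMDiffAt (𝓡 d) 𝓘(ℝ, ℝ) ∞ (fun q => θ q (X q)) p) :
    ContMDiffAt (𝓡 d) ((𝓡 d).prod 𝓘(ℝ, 𝔼 →L[ℝ] ℝ)) ∞
      (fun p => TotalSpace.mk' (𝔼 →L[ℝ] ℝ) (E := fun p : N => TangentSpace (𝓡 d) p →L[ℝ] ℝ)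
        p (θ p)) p :=
  contMDiffAt_hom_of_apply (E₂ := Bundle.Trivial N ℝ) (T := θ) fun X hX =>
    contMDiffAt_totalSpace.mpr ⟨contMDiffAt_id, h X hX⟩

theorem contMDiffAt_bilin_of_apply
    {T : ∀ p : N, TangentSpace (𝓡 d) p →L[ℝ] TangentSpace (𝓡 d) p →L[ℝ] ℝ} {p : N}
    (h : ∀ X W : VField d N, ContMDiffAt (𝓡 d) (𝓡 d).tangent ∞
        (fun q => (⟨q, X q⟩ : TangentBundle (𝓡 d) N)) p →
      ContMDiffAt (𝓡 d) (𝓡 d).tangent ∞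
        (fun q => (⟨q, W q⟩ : TangentBundle (𝓡 d) N)) p →
      ContMDiffAt (𝓡 d) 𝓘(ℝ, ℝ) ∞ (fun q => T q (X q) (W q)) p) :
    ContMDiffAt (𝓡 d) ((𝓡 d).prod 𝓘(ℝ, 𝔼 →L[ℝ] 𝔼 →L[ℝ] ℝ)) ∞
      (fun p => TotalSpace.mk' (𝔼 →L[ℝ] 𝔼 →L[ℝ] ℝ)
        (E := fun p : N => TangentSpace (𝓡 d) p →L[ℝ] TangentSpace (𝓡 d) p →L[ℝ] ℝ) p (T p)) p :=
  contMDiffAt_hom_of_apply (E₂ := fun p : N => TangentSpace (𝓡 d) p →L[ℝ] ℝ) (T := T)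
    fun X hX => contMDiffAt_covector_of_apply fun W hW => h X W hX hW

/-- If `B` is a smooth bilinear form, nondegenerate at each point, and `X` is the field which `B`
associates with a smooth covector, then `X` is smooth. -/
theorem isSmoothField_of_bilin
    {B : ∀ p : N, TangentSpace (𝓡 d) p →L[ℝ] TangentSpace (𝓡 d) p →L[ℝ] ℝ}
    {θ : ∀ p : N, TangentSpace (𝓡 d) p →L[ℝ] ℝ} {X : VField d N}
    (hB : ∀ p, ContMDiffAt (𝓡 d) ((𝓡 d).prod 𝓘(ℝ, 𝔼 →L[ℝ] 𝔼 →L[ℝ] ℝ)) ∞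
      (fun p => TotalSpace.mk' (𝔼 →L[ℝ] 𝔼 →L[ℝ] ℝ)
        (E := fun p : N => TangentSpace (𝓡 d) p →L[ℝ] TangentSpace (𝓡 d) p →L[ℝ] ℝ) p (B p)) p)
    (hinj : ∀ p v, B p v = 0 → v = 0)
    (hθ : ∀ p, ContMDiffAt (𝓡 d) ((𝓡 d).prod 𝓘(ℝ, 𝔼 →L[ℝ] ℝ)) ∞
      (fun p => TotalSpace.mk' (𝔼 →L[ℝ] ℝ) (E := fun p : N => TangentSpace (𝓡 d) p →L[ℝ] ℝ)
        p (θ p)) p)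
    (hX : ∀ p, B p (X p) = θ p) : IsSmoothField X := by
  intro p
  let e := trivializationAt 𝔼 (TangentSpace (𝓡 d) : N → Type _) p
  have he : p ∈ e.baseSet := FiberBundle.mem_baseSet_trivializationAt' p
  let e' := trivializationAt (𝔼 →L[ℝ] ℝ) (fun p : N => TangentSpace (𝓡 d) p →L[ℝ] ℝ) p
  have he' : p ∈ e'.baseSet := FiberBundle.mem_baseSet_trivializationAt' p
  have h1 := ((contMDiffAt_hom_bundle _).mp (hB p)).2
  have h2 := (contMDiffAt_totalSpace.mp (hθ p)).2
  refine contMDiffAt_totalSpace.mpr ⟨contMDiffAt_id, ?_⟩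
  set Bc : N → 𝔼 →L[ℝ] 𝔼 →L[ℝ] ℝ := fun q => ContinuousLinearMap.inCoordinates 𝔼
    (TangentSpace (𝓡 d) : N → Type _) (𝔼 →L[ℝ] ℝ) (fun p : N => TangentSpace (𝓡 d) p →L[ℝ] ℝ)
    p q p q (B q) with hBc
  set θc : N → 𝔼 →L[ℝ] ℝ := fun q => (e' ⟨q, θ q⟩).2 with hθc
  have hrel : ∀ q ∈ e.baseSet, q ∈ e'.baseSet →
      Function.Injective (Bc q) ∧ Bc q (e ⟨q, X q⟩).2 = θc q := by
    intro q hq hq'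
    have hBq : Bc q = _ := ContinuousLinearMap.inCoordinates_eq (ϕ := B q) hq hq'
    constructor
    · rw [hBq]
      have hBinj : Function.Injective (B q) := (injective_iff_map_eq_zero (B q)).mpr (hinj q)
      exact (e'.continuousLinearEquivAt ℝ q hq').injective.comp
        (hBinj.comp (e.continuousLinearEquivAt ℝ q hq).symm.injective)
    · rw [hBq, hθc]
      have : (e.continuousLinearEquivAt ℝ q hq).symm (e ⟨q, X q⟩).2 = X q := by
        rw [ContinuousLinearEquiv.symm_apply_eq]; rfl
      change e'.continuousLinearEquivAt ℝ q hq'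
        (B q ((e.continuousLinearEquivAt ℝ q hq).symm (e ⟨q, X q⟩).2)) = _
      rw [this, hX]; rfl
  have hequiv : ∀ q ∈ e.baseSet, q ∈ e'.baseSet →
      ∃ L : 𝔼 ≃L[ℝ] (𝔼 →L[ℝ] ℝ), (L : 𝔼 →L[ℝ] (𝔼 →L[ℝ] ℝ)) = Bc q := by
    intro q hq hq'
    have hfr : Module.finrank ℝ 𝔼 = Module.finrank ℝ (𝔼 →L[ℝ] ℝ) := by
      rw [← (LinearMap.toContinuousLinearMap : (𝔼 →ₗ[ℝ] ℝ) ≃ₗ[ℝ] (𝔼 →L[ℝ] ℝ)).finrank_eq]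
      exact (Subspace.dual_finrank_eq (K := ℝ) (V := 𝔼)).symm
    let L : 𝔼 ≃ₗ[ℝ] (𝔼 →L[ℝ] ℝ) :=
      LinearMap.linearEquivOfInjective (Bc q).toLinearMap (hrel q hq hq').1 hfr
    exact ⟨L.toContinuousLinearEquiv, by ext v; rfl⟩
  obtain ⟨L, hL⟩ := hequiv p he he'
  -- In coordinates `X` is `B⁻¹ θ`, and inversion of operators is smooth at an invertible one.
  have hinv : ContMDiffAt (𝓡 d) 𝓘(ℝ, (𝔼 →L[ℝ] ℝ) →L[ℝ] 𝔼) ∞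
      (fun q => ContinuousLinearMap.inverse (Bc q)) p := by
    have h3 : ContDiffAt ℝ ∞ ContinuousLinearMap.inverse (Bc p) := by
      rw [← hL]; exact contDiffAt_map_inverse L
    exact (h3.contMDiffAt).comp p h1
  refine (hinv.clm_apply h2).congr_of_eventuallyEq ?_
  filter_upwards [e.open_baseSet.mem_nhds he, e'.open_baseSet.mem_nhds he'] with q hq hq'
  obtain ⟨L, hL⟩ := hequiv q hq hq'
  change (e ⟨q, X q⟩).2 = ContinuousLinearMap.inverse (Bc q) (θc q)
  rw [← (hrel q hq hq').2, ← hL]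
  simp

end HomSections

end NullHorizon

namespace NullHorizon

open VectorField Bundle

set_option linter.unusedSectionVars false

/-! ### Pointwise algebra of the data and the horizon equations -/

section Horizons

variable {d : ℕ} {N : Type*} [TopologicalSpace N] [ChartedSpace (EuclideanSpace ℝ (Fin d)) N]
  [IsManifold (𝓡 d) ∞ N]

namespace NullMetricData

variable (D : NullMetricData d N)

theorem n_ne_zero (p : N) : D.n p ≠ 0 := by
  intro h
  have := D.ell_n p
  rw [h] at this
  simp at this

theorem gamma_apply_n (p : N) (v : TangentSpace (𝓡 d) p) : D.gamma p v (D.n p) = 0 := by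
  rw [D.gamma_symm, D.gamma_n]; rfl

theorem eq_smul_n {p : N} {v : TangentSpace (𝓡 d) p} (hv : D.gamma p v = 0) :
    v = D.ell p v • D.n p := by
  have h := (D.nondeg p (v - D.ell p v • D.n p) 0 (fun Z b => by
    simp [hv, D.gamma_n p, D.ell_n p])).1
  exact sub_eq_zero.mp h

/-- A positive semi-definite form is nonnegative on `t v + w`; with `γ(v,v) = 0` this is affine in
`t`, so its slope `2 γ(v,w)` must vanish. -/
theorem gamma_eq_zero_of_self {p : N} {v : TangentSpace (𝓡 d) p} (hv : D.gamma p v v = 0) :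
    D.gamma p v = 0 := by
  ext w
  have h (t : ℝ) : 0 ≤ 2 * t * D.gamma p v w + D.gamma p w w := by
    have := D.gamma_nonneg p (t • v + w)
    simp only [map_add, map_smul, add_apply, smul_apply,
      smul_eq_mul, hv, D.gamma_symm p w v] at this
    linarith
  by_contra hne
  have hne' : D.gamma p v w ≠ 0 := hne
  have := h (-(D.gamma p w w + 1) / (2 * D.gamma p v w))
  field_simp at this
  linarith

/-- The field `n` is defined pointwise by choice. It is the solution of `(γ + ℓ ⊗ ℓ)(n, ·) = ℓ`,
where the form on the left is smooth and nondegenerate. -/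
theorem isSmoothField_n : IsSmoothField D.n := by
  refine isSmoothField_of_bilin
    (B := fun p => D.gamma p + (D.ell p).smulRight (D.ell p)) (θ := D.ell)
    (fun p => contMDiffAt_bilin_of_apply fun X W hX hW => ?_) (fun p v hv => ?_)
    (fun p => D.ell_smooth p) (fun p => ?_)
  · exact (contMDiffAt_bilin_apply (D.gamma_smooth p) hX hW).add
      ((contMDiffAt_covector_apply (D.ell_smooth p) hX).mul
        (contMDiffAt_covector_apply (D.ell_smooth p) hW))
  · have h (Z : TangentSpace (𝓡 d) p) : D.gamma p v Z + D.ell p v * D.ell p Z = 0 := by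
      simpa using congrArg (fun L => L Z) hv
    have hl : D.ell p v = 0 := by
      simpa [D.gamma_apply_n p, D.ell_n p] using h (D.n p)
    refine (D.nondeg p v 0 fun Z b => ?_).1
    have := h Z
    rw [hl] at this ⊢
    linarith
  · ext v
    simp [D.gamma_n p, D.ell_n p]

variable {D}

theorem isSmoothFun_gamma {X W : VField d N} (hX : IsSmoothField X) (hW : IsSmoothField W) :
    IsSmoothFun (d := d) (fun p => D.gamma p (X p) (W p)) :=
  fun p => contMDiffAt_bilin_apply (D.gamma_smooth p) (hX p) (hW p)

theorem isSmoothFun_ellField {X : VField d N} (hX : IsSmoothField X) :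
    IsSmoothFun (d := d) (D.ellField X) :=
  fun p => contMDiffAt_covector_apply (D.ell_smooth p) (hX p)

theorem isSmoothFun_s {X : VField d N} (hX : IsSmoothField X) :
    IsSmoothFun (d := d) (D.s X) := by
  have hn := D.isSmoothField_n
  exact ContMDiff.mul contMDiff_const
    (IsSmoothFun.sub (((isSmoothFun_ellField hX).dir hn).sub ((isSmoothFun_ellField hn).dir hX))
      (isSmoothFun_ellField (hn.bracket hX)))

theorem isSmoothFun_lieBilin_gamma {X W Z : VField d N} (hX : IsSmoothField X)
    (hW : IsSmoothField W) (hZ : IsSmoothField Z) :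
    IsSmoothFun (d := d) (lieBilin X D.gamma W Z) :=
  IsSmoothFun.sub (((isSmoothFun_gamma hW hZ).dir hX).sub (isSmoothFun_gamma (hX.bracket hW) hZ))
    (isSmoothFun_gamma hW (hX.bracket hZ))

theorem ellField_n : D.ellField D.n = fun _ => 1 := funext D.ell_n

theorem s_n (p : N) : D.s D.n p = 0 := by
  simp [s, F, bracket_self, ellField]

/-- `s` only sees the class of a field modulo the radical. -/
theorem s_smul_n_add {h : N → ℝ} {Z : VField d N} (hh : IsSmoothFun (d := d) h)
    (hZ : IsSmoothField Z) (p : N) :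
    D.s (fun q => h q • D.n q + Z q) p = D.s Z p := by
  have hn := D.isSmoothField_n
  have h1 : D.ellField (fun q => h q • D.n q + Z q) = fun q => h q + D.ellField Z q := by
    funext q; simp [ellField, D.ell_n q]
  have h2 : D.ellField (bracket D.n fun q => h q • D.n q + Z q) p =
      dir D.n h p + D.ellField (bracket D.n Z) p := by
    simp only [ellField]
    rw [bracket_add_right (IsSmoothField.smul hh hn) hZ, bracket_smul_right hh hn, bracket_self]
    simp [D.ell_n p]
  simp only [s, F]
  rw [h1, h2, dir_add hh (isSmoothFun_ellField hZ), ellField_n, dir_const, dir_const]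
  ring

/-- Here `s` is an operation on fields rather than a bundled linear map, so the zero field is
written as `-n + n`, whose value agrees with `s(n) = 0`. -/
theorem s_zero (p : N) : D.s (fun q => (0 : TangentSpace (𝓡 d) q)) p = 0 := by
  have h := s_smul_n_add (D := D) (h := fun _ => -1) contMDiff_const D.isSmoothField_n p
  simp only [neg_smul, one_smul, neg_add_cancel] at h
  rw [h, s_n]

theorem s_smul_n {h : N → ℝ} (hh : IsSmoothFun (d := d) h) (p : N) :
    D.s (fun q => h q • D.n q) p = 0 := by
  have h0 : IsSmoothField (fun q => (0 : ℝ) • D.n q) :=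
    IsSmoothField.smul (f := fun _ => 0) contMDiff_const D.isSmoothField_n
  simpa only [zero_smul, add_zero, s_zero] using s_smul_n_add hh h0 p

/-- The derivatives of `h` enter only through multiples of `n` inside `γ`, and `n` lies in the
radical. -/
theorem lieBilin_smul_n {h : N → ℝ} {X W : VField d N} (hh : IsSmoothFun (d := d) h) (p : N) :
    lieBilin (fun q => h q • D.n q) D.gamma X W p = h p * lieBilin D.n D.gamma X W p := by
  simp only [lieBilin]
  rw [bracket_smul_left hh D.isSmoothField_n, bracket_smul_left hh D.isSmoothField_n,
    dir_smul_left]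
  simp [D.gamma_n p, D.gamma_apply_n p]
  ring

theorem U_n (X : VField d N) (p : N) : D.U X D.n p = 0 := by
  have : (fun q => D.gamma q (X q) (D.n q)) = fun _ => 0 := funext fun q => D.gamma_apply_n q _
  simp [U, lieBilin, this, dir_const, bracket_self, D.gamma_apply_n p]

/-- With `U = 0`, `∇γ = 0` puts `∇_W n` in the radical, and `∇ℓ = F` fixes its `ℓ`-component as
`-F(W, n) = s(W)`. -/
theorem nab_n {nab : CovariantDerivative (𝓡 d) (EuclideanSpace ℝ (Fin d))
      (TangentSpace (𝓡 d) : N → Type _)} (hnab : D.IsMetricConnection nab)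
    (hU : ∀ X W : VField d N, IsSmoothField X → IsSmoothField W → ∀ p, D.U X W p = 0)
    {W : VField d N} (hW : IsSmoothField W) (p : N) :
    nab D.n p (W p) = D.s W p • D.n p := by
  have hn := D.isSmoothField_n
  have hg : D.gamma p (nab D.n p (W p)) = 0 := by
    refine D.gamma_eq_zero_of_self ?_
    have hZ := hnab.smooth W D.n hW hn
    -- Testing against `∇_W n` itself gives `γ(∇_W n, ∇_W n) = 0`, which suffices by
    -- semi-definiteness and avoids extending arbitrary tangent vectors to fields.
    have h := hnab.nabla_gamma W D.n (fun q => nab D.n q (W q)) hW hn hZ p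
    rw [hU W _ hW hZ, U_n] at h
    simpa [D.gamma_n, dir_const] using h
  have hl : D.ell p (nab D.n p (W p)) = D.s W p := by
    have h := hnab.nabla_ell W D.n hW hn p
    rw [U_n, ellField_n, dir_const] at h
    have h2 : D.F W D.n p = - D.s W p := by
      simp only [s, F, ellField]
      rw [bracket_swap, map_neg]; ring
    rw [h2] at h; linarith
  rw [D.eq_smul_n hg, hl]

end NullMetricData

namespace NullData

open NullMetricData

variable {D : NullData d N} {η : VField d N}

theorem isSmoothFun_Y {X W : VField d N} (hX : IsSmoothField X) (hW : IsSmoothField W) :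
    IsSmoothFun (d := d) (fun p => D.Y p (X p) (W p)) :=
  fun p => contMDiffAt_bilin_apply (D.Y_smooth p) (hX p) (hW p)

theorem isSmoothFun_r {X : VField d N} (hX : IsSmoothField X) : IsSmoothFun (d := d) (D.r X) :=
  isSmoothFun_Y D.isSmoothField_n hX

theorem isSmoothFun_kappaN : IsSmoothFun (d := d) D.kappaN :=
  (isSmoothFun_Y D.isSmoothField_n D.isSmoothField_n).neg

theorem r_n (p : N) : D.r D.n p = - D.kappaN p := by simp [r, kappaN]

theorem isSmoothFun_alpha (hη : IsSmoothField η) : IsSmoothFun (d := d) (D.alpha η) :=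
  isSmoothFun_ellField hη

theorem kappa_eq (p : N) :
    D.kappa η p = dir D.n (D.alpha η) p + D.alpha η p * D.kappaN p := by
  simp [kappa, kappaN, sub_eq_add_neg]

theorem isSmoothFun_kappa (hη : IsSmoothField η) : IsSmoothFun (d := d) (D.kappa η) := by
  have hα := isSmoothFun_alpha (D := D) hη
  have : D.kappa η = fun p => dir D.n (D.alpha η) p + D.alpha η p * D.kappaN p :=
    funext fun p => kappa_eq p
  rw [this]
  exact (hα.dir D.isSmoothField_n).add (hα.mul isSmoothFun_kappaN)

/-- From `£_η γ = α £_n γ` the tensor `£_n γ` vanishes off the fixed set, which is dense; continuity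
does the rest. -/
theorem IsAKH0.lieBilin_n (h : D.IsAKH0 η) {X W : VField d N} (hX : IsSmoothField X)
    (hW : IsSmoothField W) (p : N) : lieBilin D.n D.gamma X W p = 0 := by
  have hα := isSmoothFun_alpha (D := D) h.smooth
  have hη : η = fun q => D.alpha η q • D.n q := funext fun q => D.eq_alpha_smul_n η h.mem_rad q
  have hdense : Dense (fixedSet η)ᶜ := interior_eq_empty_iff_dense_compl.mp h.interior_fixed
  have hcont := (isSmoothFun_lieBilin_gamma D.isSmoothField_n hX hW :
    IsSmoothFun (d := d) (lieBilin D.n D.gamma X W)).continuous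
  refine congrFun (hcont.ext_on hdense (continuous_const (y := (0 : ℝ))) fun q hq => ?_) p
  have h0 := h.lie_gamma X W hX hW q
  rw [hη, lieBilin_smul_n hα] at h0
  refine (mul_eq_zero.mp h0).resolve_left fun ha => hq ?_
  change η q = 0
  rw [D.eq_alpha_smul_n η h.mem_rad q, ha, zero_smul]

theorem IsAKH0.U_eq_zero (h : D.IsAKH0 η) {X W : VField d N} (hX : IsSmoothField X)
    (hW : IsSmoothField W) (p : N) : D.U X W p = 0 := by
  simp [U, h.lieBilin_n hX hW]

/-- Contract with `n` in one slot. Since `∇_W n = s(W) n` and `∇_n W = s(W) n + [n, W]`, the Hessian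
becomes `W(n(α)) - s(W) n(α)`; the terms `n(α) s(W)` and `n(α) r(W)` then cancel, and `r(n) = -κ_n`
supplies the last term of the weak equation. -/
theorem IsAKH1.isAWKH1 (h : D.IsAKH1 η) : D.IsAWKH1 η := by
  refine ⟨h.toIsAKH0, fun W hW p => ?_⟩
  have hn := D.isSmoothField_n
  have hα := isSmoothFun_alpha (D := D) h.smooth
  obtain ⟨nab, hnab, heq⟩ := h.order_one_eq
  have hU : ∀ X W : VField d N, IsSmoothField X → IsSmoothField W → ∀ p, D.U X W p = 0 :=
    fun X W hX hW p => h.toIsAKH0.U_eq_zero hX hW p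
  have hsW := isSmoothFun_s (D := D.toNullMetricData) hW
  have hrW := isSmoothFun_r (D := D) hW
  have h1 : (fun q => nab D.n q (W q)) = fun q => D.s W q • D.n q :=
    funext fun q => nab_n hnab hU hW q
  have h2 : (fun q => nab W q (D.n q)) = fun q => D.s W q • D.n q + bracket D.n W q := by
    funext q
    have := hnab.torsion_free D.n W hn hW q
    rw [nab_n hnab hU hW q, sub_eq_iff_eq_add] at this
    rw [this, add_comm]
  have h4 : dir D.n (fun q => D.s W q - D.r W q) p = dir D.n (D.s W) p - dir D.n (D.r W) p :=
    dir_sub hsW hrW p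
  have h5 : lieBilin D.n D.Y D.n W p = dir D.n (D.r W) p - D.r (bracket D.n W) p := by
    simp [lieBilin, bracket_self, r]
    rfl
  have h6 := dir_bracket hn hW hn hα (D.n_ne_zero p)
  have hE := heq D.n W hn hW p
  rw [h2, h1, s_smul_n_add hsW (hn.bracket hW), s_smul_n hsW, dir_add_left, dir_smul_left, h5, h6, s_n, r_n] at hE
  have h7 : dir W (D.s D.n) p = 0 := by
    have : D.s D.n = fun _ => 0 := funext fun q => s_n q
    rw [this, dir_const]
  rw [h7] at hE
  have h8 : D.Y p (D.n p) (W p) = D.r W p := rfl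
  rw [h8] at hE
  simp only [lieCovector]
  rw [h4]
  linarith

/-- The weak equation evaluated on `n` is `α n(κ_n) + n(n(α)) + κ_n n(α) = 0`, the expansion of
`n(n(α) + α κ_n)`. -/
theorem IsAWKH1.dir_n_kappa (h : D.IsAWKH1 η) (p : N) : dir D.n (D.kappa η) p = 0 := by
  have hn := D.isSmoothField_n
  have hα := isSmoothFun_alpha (D := D) h.smooth
  have hk : D.kappa η = fun p => dir D.n (D.alpha η) p + D.alpha η p * D.kappaN p :=
    funext fun p => kappa_eq p
  have h1 : (fun q => D.s D.n q - D.r D.n q) = D.kappaN := by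
    funext q; rw [s_n, r_n]; ring
  have h2 := h.weak_eq D.n hn p
  have h3 : bracket D.n D.n = fun q => (0 : TangentSpace (𝓡 d) q) :=
    funext fun q => bracket_self D.n q
  simp only [lieCovector] at h2
  rw [h1, h3, s_zero] at h2
  have h4 : D.r (fun q => (0 : TangentSpace (𝓡 d) q)) p = 0 := by simp [r]
  rw [hk, dir_add (hα.dir hn) (hα.mul isSmoothFun_kappaN), dir_mul hα isSmoothFun_kappaN]
  rw [h4] at h2
  linarith

/-! ### Gauge behaviour of `n`, `α`, `κ_n` and `κ` -/

section Gauge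

variable {D' : NullData d N} {z : N → ℝ} {V : VField d N}

theorem IsGaugeTransform.n_eq (G : D.IsGaugeTransform D' z V) (p : N) :
    D'.n p = (z p)⁻¹ • D.n p := by
  have h1 : D.gamma p (D'.n p) = 0 := by rw [← G.gamma_eq, D'.gamma_n]
  have h2 := D'.ell_n p
  have h3 : D.gamma p (V p) (D'.n p) = 0 := by rw [D.gamma_symm, h1]; rfl
  rw [G.ell_eq, h3, add_zero] at h2
  rw [D.eq_smul_n h1, eq_inv_of_mul_eq_one_right h2]

theorem IsGaugeTransform.dir_n (G : D.IsGaugeTransform D' z V) (f : N → ℝ) (p : N) :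
    dir D'.n f p = (z p)⁻¹ * dir D.n f p := by
  simp [dir, G.n_eq p]

theorem IsGaugeTransform.alpha_eq (G : D.IsGaugeTransform D' z V)
    (hη : ∀ p, D.gamma p (η p) = 0) (p : N) : D'.alpha η p = z p * D.alpha η p := by
  have h : D.gamma p (V p) (η p) = 0 := by rw [D.gamma_symm, hη]; rfl
  rw [alpha, G.ell_eq, h, add_zero, alpha]

/-- The contribution of `V` is `£_{zV} γ` evaluated twice on a field in the radical, hence zero;
only `z` matters. -/
theorem IsGaugeTransform.kappaN_eq (G : D.IsGaugeTransform D' z V) (p : N) :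
    D'.kappaN p = (z p)⁻¹ * (D.kappaN p - (z p)⁻¹ * dir D.n z p) := by
  have hz := G.z_ne p
  have hn := D'.isSmoothField_n
  have hg (q : N) : D.gamma q (D'.n q) = 0 := by rw [← G.gamma_eq, D'.gamma_n]
  have hg' (q : N) (v : TangentSpace (𝓡 d) q) : D.gamma q v (D'.n q) = 0 := by
    rw [← G.gamma_eq, D'.gamma_apply_n]
  have h := G.Y_eq D'.n D'.n hn hn p
  have hl : lieBilin (fun q => z q • V q) D.gamma D'.n D'.n p = 0 := by
    simp [lieBilin, hg, hg', dir_const]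
  rw [hl, G.dir_n, G.n_eq p] at h
  simp only [map_smul, smul_apply, smul_eq_mul, D.ell_n] at h
  simp only [kappaN]
  rw [G.n_eq p]
  simp only [map_smul, smul_apply, smul_eq_mul, h]
  field_simp
  ring

theorem IsGaugeTransform.kappa_eq (G : D.IsGaugeTransform D' z V) (hη : IsSmoothField η)
    (hr : ∀ p, D.gamma p (η p) = 0) (p : N) : D'.kappa η p = D.kappa η p := by
  have hz := G.z_ne p
  have h : D'.alpha η = fun q => z q * D.alpha η q := funext fun q => G.alpha_eq hr q
  rw [NullData.kappa_eq, NullData.kappa_eq, G.kappaN_eq, G.dir_n, h,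
    dir_mul G.z_smooth (isSmoothFun_alpha hη)]
  field_simp
  ring

/-- The gauge transform with parameters `(z, 0)`. -/
def rescale (D : NullData d N) (z : N → ℝ) (hz : IsSmoothFun (d := d) z) (hz0 : ∀ p, z p ≠ 0) :
    NullData d N where
  gamma := D.gamma
  ell p := z p • D.ell p
  ell2 p := z p ^ 2 * D.ell2 p
  gamma_smooth := D.gamma_smooth
  ell_smooth p := contMDiffAt_covector_of_apply fun _ hX =>
    (hz p).mul (contMDiffAt_covector_apply (D.ell_smooth p) hX)
  ell2_smooth := ContMDiff.mul (ContMDiff.pow hz 2) D.ell2_smooth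
  gamma_symm := D.gamma_symm
  gamma_nonneg := D.gamma_nonneg
  gamma_radical := D.gamma_radical
  nondeg p W a h := by
    have := D.nondeg p W (a * z p) fun Z b => by
      -- Rescaling `ℓ` is undone by rescaling the real components: the new form on `(W, a)`, `(Z, b
      -- / z)` is the old one on `(W, a z)`, `(Z, b)`.
      have := h Z (b / z p)
      simp only [smul_apply, smul_eq_mul] at this
      rw [← this]
      field_simp [hz0 p]
    exact ⟨this.1, (mul_eq_zero.mp this.2).resolve_right (hz0 p)⟩
  Y p := z p • D.Y p + (1 / 2 : ℝ) • ((D.ell p).smulRight (mvfderiv (𝓡 d) z p) +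
    (mvfderiv (𝓡 d) z p).smulRight (D.ell p))
  Y_smooth p := contMDiffAt_bilin_of_apply fun X W hX hW => by
    have hdz {X : VField d N} (hX : ContMDiffAt (𝓡 d) (𝓡 d).tangent ∞
        (fun q => (⟨q, X q⟩ : TangentBundle (𝓡 d) N)) p) :
        ContMDiffAt (𝓡 d) 𝓘(ℝ, ℝ) ∞ (fun q => mvfderiv (𝓡 d) z q (X q)) p :=
      ((contMDiff_snd_tangentBundle_modelSpace ℝ 𝓘(ℝ, ℝ) (n := ∞)).comp
        (ContMDiff.contMDiff_tangentMap hz (m := ∞) (by simp))).contMDiffAt.comp p hX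
    have hl {X : VField d N} (hX : ContMDiffAt (𝓡 d) (𝓡 d).tangent ∞
        (fun q => (⟨q, X q⟩ : TangentBundle (𝓡 d) N)) p) :=
      contMDiffAt_covector_apply (D.ell_smooth p) hX
    exact ((hz p).mul (contMDiffAt_bilin_apply (D.Y_smooth p) hX hW)).add
      (contMDiffAt_const.mul (((hl hX).mul (hdz hW)).add ((hdz hX).mul (hl hW))))
  Y_symm p v w := by
    simp [D.Y_symm p v w]
    ring

theorem isGaugeTransform_rescale {hz : IsSmoothFun (d := d) z} {hz0 : ∀ p, z p ≠ 0} :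
    D.IsGaugeTransform (D.rescale z hz hz0) z (fun _ => 0) where
  z_smooth := hz
  z_ne := hz0
  V_smooth := by
    have : IsSmoothField (fun q => (0 : ℝ) • D.n q) :=
      IsSmoothField.smul (f := fun _ => 0) contMDiff_const D.isSmoothField_n
    simpa only [zero_smul] using this
  gamma_eq _ := rfl
  ell_eq p v := by simp [rescale]
  ell2_eq p := by simp [rescale]
  Y_eq X W hX hW p := by
    have hb (X : VField d N) : bracket (fun q => z q • (0 : TangentSpace (𝓡 d) q)) X p = 0 := by
      simp only [smul_zero]
      exact congrFun (mlieBracket_zero_left (W := X) (I := 𝓡 d)) p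
    have hl : lieBilin (fun q => z q • (0 : TangentSpace (𝓡 d) q)) D.gamma X W p = 0 := by
      simp only [lieBilin, hb]
      simp [dir]
    rw [hl]
    simp [rescale, dir]
    ring

end Gauge

end NullData

end Horizons

end NullHorizon

namespace NullHorizon

/-! ### Composition operators on spaces of continuous functions -/

section Nemytskii

universe u

variable {K : Type*} [TopologicalSpace K] [CompactSpace K]
  {E F G : Type u} [NormedAddCommGroup E] [NormedSpace ℝ E] [NormedAddCommGroup F]
  [NormedSpace ℝ F] [NormedAddCommGroup G] [NormedSpace ℝ G]

variable (K) in
/-- Pointwise application of a bilinear map to continuous functions on a compact space. -/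
def pointwiseApply (B : G →L[ℝ] E →L[ℝ] F) : C(K, G) →L[ℝ] C(K, E) →L[ℝ] C(K, F) :=
  LinearMap.mkContinuous₂
    (LinearMap.mk₂ ℝ (fun (A : C(K, G)) (c : C(K, E)) =>
      (⟨fun s => B (A s) (c s), by fun_prop⟩ : C(K, F)))
      (fun A B c => by ext; simp) (fun r A c => by ext; simp)
      (fun A c e => by ext; simp) (fun r A c => by ext; simp)) ‖B‖
    (fun A c => by
      rw [ContinuousMap.norm_le _ (by positivity)]
      intro s
      refine (B.le_opNorm₂ (A s) (c s)).trans ?_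
      gcongr
      · exact A.norm_coe_le_norm s
      · exact c.norm_coe_le_norm s)

/-- The range of `c` is compact, so the derivative of `f` is uniformly continuous near it; the mean
value inequality then bounds the remainder uniformly over `K`. -/
theorem hasFDerivAt_postcomp {B : G →L[ℝ] E →L[ℝ] F} {f : C(E, F)} {f' : C(E, G)}
    (hf : ∀ x, HasFDerivAt f (B (f' x)) x) (c : C(K, E)) :
    HasFDerivAt (fun c : C(K, E) => f.comp c) (pointwiseApply K B (f'.comp c)) c := by
  rw [hasFDerivAt_iff_isLittleO_nhds_zero, Asymptotics.isLittleO_iff]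
  intro ε hε
  have hunif := (isCompact_range c.continuous).uniformContinuousAt_of_continuousAt
    (fun x => B (f' x)) (fun a _ => by fun_prop) (Metric.dist_mem_uniformity hε)
  obtain ⟨δ, hδ, hδε⟩ := Metric.mem_uniformity_dist.mp hunif
  filter_upwards [Metric.ball_mem_nhds (0 : C(K, E)) hδ] with h hh
  rw [mem_ball_zero_iff] at hh
  rw [ContinuousMap.norm_le _ (by positivity)]
  intro s
  have hs : ‖h s‖ < δ := (h.norm_coe_le_norm s).trans_lt hh
  have key := (convex_ball (c s) δ).norm_image_sub_le_of_norm_hasFDerivWithin_le' (f := f)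
    (f' := fun x => B (f' x)) (φ := B (f' (c s))) (C := ε) (x := c s) (y := c s + h s)
    (fun x _ => (hf x).hasFDerivWithinAt) (fun x hx => by
      rw [← dist_eq_norm, dist_comm]
      exact (hδε (a := c s) (b := x) (by rwa [dist_comm]) ⟨s, rfl⟩).le)
    (Metric.mem_ball_self hδ) (by simpa using hs)
  simp only [add_sub_cancel_left] at key
  exact key.trans (mul_le_mul_of_nonneg_left (h.norm_coe_le_norm s) hε.le)

/-- The derivative of composition with `f` is composition with `f'` followed by a bounded linear
map, so each derivative of `f` yields one of the operator. -/
theorem contDiff_postcomp_succ {B : G →L[ℝ] E →L[ℝ] F} {f : C(E, F)} {f' : C(E, G)}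
    (hf : ∀ x, HasFDerivAt f (B (f' x)) x) {n : ℕ}
    (hn : ContDiff ℝ n (fun c : C(K, E) => f'.comp c)) :
    ContDiff ℝ (n + 1) (fun c : C(K, E) => f.comp c) := by
  have hd (c : C(K, E)) := hasFDerivAt_postcomp hf c
  rw [contDiff_succ_iff_fderiv]
  refine ⟨fun c => (hd c).differentiableAt, by simp, ?_⟩
  rw [show fderiv ℝ (fun c : C(K, E) => f.comp c) = fun c => pointwiseApply K B (f'.comp c)
    from funext fun c => (hd c).fderiv]
  exact (pointwiseApply K B).contDiff.comp hn

/-- Composition with a smooth map is a smooth map between spaces of continuous functions on a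
compact space. -/
theorem contDiff_postcomp {f : E → F} (hf : ContDiff ℝ ∞ f) :
    ContDiff ℝ ∞ (fun c : C(K, E) => (⟨f, hf.continuous⟩ : C(E, F)).comp c) := by
  rw [contDiff_infty]
  intro n
  -- The target must vary: the inductive step passes to `fderiv ℝ f`, valued in `E →L[ℝ] F`.
  induction n generalizing F with
  | zero => exact contDiff_zero.mpr (ContinuousMap.continuous_postcomp _)
  | succ n ih =>
    have hf' : ContDiff ℝ ∞ (fderiv ℝ f) := hf.fderiv_right (by simp)
    exact contDiff_postcomp_succ (G := E →L[ℝ] F) (B := .id ℝ _)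
      (f' := ⟨fderiv ℝ f, hf'.continuous⟩)
      (fun x => (hf.differentiable (by simp) x).hasFDerivAt) (ih hf')

end Nemytskii

/-! ### The inverse function theorem with smooth inverse -/

section InverseFunction

variable {E F : Type*} [NormedAddCommGroup E] [NormedSpace ℝ E] [CompleteSpace E]
  [NormedAddCommGroup F] [NormedSpace ℝ F]

/-- The inverse function theorem, with an inverse that is smooth on a neighbourhood. -/
theorem exists_openPartialHomeomorph_contDiffOn {f : E → F} {s : Set E} {a : E} {f' : E ≃L[ℝ] F}
    (hs : IsOpen s) (ha : a ∈ s) (hf : ContDiffOn ℝ ∞ f s)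
    (hf' : HasFDerivAt f (f' : E →L[ℝ] F) a) :
    ∃ Φ : OpenPartialHomeomorph E F, a ∈ Φ.source ∧ Φ.source ⊆ s ∧ (∀ x, Φ x = f x) ∧
      ContDiffOn ℝ ∞ Φ.symm Φ.target := by
  have hfa : ContDiffAt ℝ ∞ f a := hf.contDiffAt (hs.mem_nhds ha)
  have hcont : ContinuousOn (fderiv ℝ f) s :=
    hf.continuousOn_fderiv_of_isOpen hs (by simp)
  -- Shrinking to points where the derivative is invertible, an open condition, gives smoothness of
  -- the inverse on the whole target and not only at the image of `a`.
  have hopen : IsOpen (s ∩ fderiv ℝ f ⁻¹' Set.range ((↑) : (E ≃L[ℝ] F) → E →L[ℝ] F)) :=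
    hcont.isOpen_inter_preimage hs ContinuousLinearEquiv.isOpen
  let Φ₀ := hfa.toOpenPartialHomeomorph f hf' (by simp)
  let Φ := Φ₀.restrOpen _ hopen
  have hsrc : Φ.source = Φ₀.source ∩ (s ∩ fderiv ℝ f ⁻¹' Set.range
      ((↑) : (E ≃L[ℝ] F) → E →L[ℝ] F)) := Φ₀.restrOpen_source _ hopen
  refine ⟨Φ, ?_, ?_, fun x => rfl, fun y hy => ?_⟩
  · rw [hsrc]
    exact ⟨hfa.mem_toOpenPartialHomeomorph_source hf' (by simp), ha, f', hf'.fderiv.symm⟩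
  · rw [hsrc]
    exact fun x hx => hx.2.1
  · have hx := Φ.map_target hy
    rw [hsrc] at hx
    obtain ⟨-, hxs, L, hL⟩ := hx
    have hfx := hf.contDiffAt (hs.mem_nhds hxs)
    refine (Φ.contDiffAt_symm (f₀' := L) hy ?_ hfx).contDiffWithinAt
    rw [hL]
    exact (hfx.differentiableAt (by simp)).hasFDerivAt

end InverseFunction

end NullHorizon

namespace NullHorizon

set_option linter.unusedSectionVars false

/-! ### Smooth dependence of local flows on time and initial value -/

section LocalFlow

open Set Metric

variable {E : Type*} [NormedAddCommGroup E] [NormedSpace ℝ E]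

local notation "𝕂" => Icc (-1 : ℝ) 1

variable (E) in
/-- Constant functions, as a continuous linear map. -/
def constMap : E →L[ℝ] C(𝕂, E) :=
  LinearMap.mkContinuous
    { toFun := fun x => ContinuousMap.const _ x
      map_add' := fun _ _ => rfl
      map_smul' := fun _ _ => rfl } 1
    (fun x => by
      rw [one_mul]
      exact (ContinuousMap.norm_le _ (norm_nonneg x)).mpr fun _ => le_rfl)

@[simp]
theorem constMap_apply (x : E) (s : 𝕂) : constMap E x s = x := rfl

theorem continuous_IccExtend (g : C(𝕂, E)) : Continuous (IccExtend (neg_le_self zero_le_one) g) :=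
  g.continuous.Icc_extend'

theorem continuous_integral_IccExtend (g : C(𝕂, E)) :
    Continuous (fun s : ℝ => ∫ τ in (0 : ℝ)..s, IccExtend (neg_le_self zero_le_one) g τ) :=
  intervalIntegral.continuous_primitive (fun _ _ => (continuous_IccExtend g).intervalIntegrable _ _) 0

variable (E) in
/-- The primitive vanishing at zero, as a continuous linear map. -/
def primitiveMap : C(𝕂, E) →L[ℝ] C(𝕂, E) :=
  LinearMap.mkContinuous
    { toFun := fun g => ⟨fun s => ∫ τ in (0 : ℝ)..s, IccExtend (neg_le_self zero_le_one) g τ,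
        (continuous_integral_IccExtend g).comp continuous_subtype_val⟩
      map_add' := fun f g => by
        ext s
        exact intervalIntegral.integral_add ((continuous_IccExtend f).intervalIntegrable _ _)
          ((continuous_IccExtend g).intervalIntegrable _ _)
      map_smul' := fun r g => by
        ext s
        exact intervalIntegral.integral_smul r _ } 1
    (fun g => by
      rw [one_mul]
      refine (ContinuousMap.norm_le _ (norm_nonneg g)).mpr fun s => ?_
      have h := intervalIntegral.norm_integral_le_of_norm_le_const (a := 0) (b := (s : ℝ))
        (C := ‖g‖) (f := IccExtend (neg_le_self zero_le_one) g)
        (fun τ _ => g.norm_coe_le_norm _)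
      refine h.trans (mul_le_of_le_one_right (norm_nonneg g) ?_)
      rw [sub_zero, abs_le]
      exact s.2)

theorem primitiveMap_apply (g : C(𝕂, E)) (s : 𝕂) :
    primitiveMap E g s = ∫ τ in (0 : ℝ)..s, IccExtend (neg_le_self zero_le_one) g τ := rfl

/-- Multiplication by a fixed number of absolute value at most one. -/
def scaleMap (s : 𝕂) : C(𝕂, 𝕂) :=
  ⟨fun τ => ⟨s * τ, by
    rw [mem_Icc, ← abs_le, abs_mul]
    exact mul_le_one₀ (abs_le.mpr s.2) (abs_nonneg _) (abs_le.mpr τ.2)⟩, by fun_prop⟩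

theorem primitiveMap_comp_scaleMap (g : C(𝕂, E)) (s τ : 𝕂) :
    (s : ℝ) • primitiveMap E (g.comp (scaleMap s)) τ = primitiveMap E g (scaleMap s τ) := by
  rw [primitiveMap_apply, primitiveMap_apply]
  change _ = ∫ τ in (0 : ℝ)..((s : ℝ) * τ), _
  have := intervalIntegral.smul_integral_comp_mul_left (a := 0) (b := (τ : ℝ))
    (IccExtend (neg_le_self zero_le_one) g) (s : ℝ)
  rw [mul_zero] at this
  rw [← this]
  congr 1
  refine intervalIntegral.integral_congr fun u hu => ?_
  have hu' : u ∈ 𝕂 := (uIcc_subset_Icc (by simp) τ.2) hu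
  rw [IccExtend_of_mem _ _ hu']
  exact (IccExtend_of_mem _ _ (scaleMap s ⟨u, hu'⟩).2).symm

variable [CompleteSpace E]

/-- Smooth dependence of the local flow of a smooth vector field on time and initial value. -/
theorem exists_local_flow {v : E → E} (hv : ContDiff ℝ ∞ v) (x₀ : E) :
    ∃ ε > 0, ∃ φ : ℝ × E → E, ContDiffOn ℝ ∞ φ (Ioo (-ε) ε ×ˢ ball x₀ ε) ∧
      (∀ x ∈ ball x₀ ε, φ (0, x) = x) ∧
      ∀ t ∈ Ioo (-ε) ε, ∀ x ∈ ball x₀ ε, HasDerivAt (fun s => φ (s, x)) (v (φ (t, x))) t := by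
  let Nv : C(𝕂, E) → C(𝕂, E) := fun c => (⟨v, hv.continuous⟩ : C(E, E)).comp c
  have hN : ContDiff ℝ ∞ Nv := contDiff_postcomp hv
  -- Time is rescaled to the fixed interval `[-1, 1]`: the second component vanishes iff `c(s) = x +
  -- t ∫₀ˢ v(c)`, which is solved by `c(s) = φ(s t, x)`. At `t = 0` the derivative of `G` is
  -- unipotent, so its inverse `f₂` only changes a sign.
  let G : (ℝ × E) × C(𝕂, E) → (ℝ × E) × C(𝕂, E) :=
    fun p => (p.1, p.2 - constMap E p.1.2 - p.1.1 • primitiveMap E (Nv p.2))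
  have hG : ContDiff ℝ ∞ G := by
    refine contDiff_fst.prodMk ((contDiff_snd.sub ?_).sub ?_)
    · exact (constMap E).contDiff.comp (contDiff_snd.comp contDiff_fst)
    · exact (contDiff_fst.comp contDiff_fst).smul
        ((primitiveMap E).contDiff.comp (hN.comp contDiff_snd))
  let c₀ : C(𝕂, E) := constMap E x₀
  let w₀ : ℝ × E := (0, x₀)
  let M : (ℝ × E) →L[ℝ] C(𝕂, E) := constMap E ∘L ContinuousLinearMap.snd ℝ ℝ E +
    (ContinuousLinearMap.fst ℝ ℝ E).smulRight (primitiveMap E (Nv c₀))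
  let f₁ : (ℝ × E) × C(𝕂, E) →L[ℝ] (ℝ × E) × C(𝕂, E) := (ContinuousLinearMap.fst ℝ _ _).prod
    (ContinuousLinearMap.snd ℝ _ _ - M ∘L ContinuousLinearMap.fst ℝ _ _)
  let f₂ : (ℝ × E) × C(𝕂, E) →L[ℝ] (ℝ × E) × C(𝕂, E) := (ContinuousLinearMap.fst ℝ _ _).prod
    (ContinuousLinearMap.snd ℝ _ _ + M ∘L ContinuousLinearMap.fst ℝ _ _)
  let L : ((ℝ × E) × C(𝕂, E)) ≃L[ℝ] (ℝ × E) × C(𝕂, E) :=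
    ContinuousLinearEquiv.equivOfInverse f₁ f₂ (fun p => by simp [f₁, f₂])
      (fun p => by simp [f₁, f₂])
  have hL : HasFDerivAt G (L : (ℝ × E) × C(𝕂, E) →L[ℝ] (ℝ × E) × C(𝕂, E)) (w₀, c₀) := by
    have h1 := HasFDerivAt.smul (HasFDerivAt.comp (w₀, c₀) (hasFDerivAt_fst (𝕜 := ℝ) (p := w₀))
        (hasFDerivAt_fst (𝕜 := ℝ) (p := (w₀, c₀))))
      ((primitiveMap E).hasFDerivAt.comp _
        ((hN.differentiable (by simp) c₀).hasFDerivAt.comp (w₀, c₀) hasFDerivAt_snd))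
    have h2 : HasFDerivAt G _ (w₀, c₀) := hasFDerivAt_fst.prodMk ((hasFDerivAt_snd.sub
      ((constMap E).hasFDerivAt.comp (w₀, c₀) (hasFDerivAt_snd.comp _ hasFDerivAt_fst))).sub h1)
    refine h2.congr_fderiv ?_
    refine ContinuousLinearMap.ext fun p => Prod.ext rfl ?_
    simp [L, f₁, M, w₀, sub_sub]
  obtain ⟨Φ, haΦ, -, hΦG, hΦs⟩ := exists_openPartialHomeomorph_contDiffOn isOpen_univ
    (mem_univ (w₀, c₀)) hG.contDiffOn hL
  obtain ⟨r, hr, hrΦ⟩ := Metric.isOpen_iff.mp Φ.open_source _ haΦ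
  have hG₀ : G (w₀, c₀) = (w₀, 0) := by simp [G, w₀, c₀]
  have hmem : (w₀, (0 : C(𝕂, E))) ∈ Φ.target := by
    rw [← hG₀, ← hΦG]; exact Φ.map_source haΦ
  have hinv : Φ.symm (w₀, 0) = (w₀, c₀) := by
    rw [← hG₀, ← hΦG]; exact Φ.left_inv haΦ
  have hnhds : {w : ℝ × E | (w, (0 : C(𝕂, E))) ∈ Φ.target ∧ Φ.symm (w, 0) ∈ ball (w₀, c₀) r} ∈
      𝓝 w₀ := by
    have hc : ContinuousAt (fun w : ℝ × E => (w, (0 : C(𝕂, E)))) w₀ := by fun_prop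
    have h1 := hc.preimage_mem_nhds (Φ.open_target.mem_nhds hmem)
    have h2 : ContinuousAt (fun w : ℝ × E => Φ.symm (w, (0 : C(𝕂, E)))) w₀ :=
      ContinuousAt.comp (g := Φ.symm) (Φ.continuousAt_symm hmem) hc
    have h3 := h2.preimage_mem_nhds (t := ball (w₀, c₀) r)
      (by rw [hinv]; exact ball_mem_nhds _ hr)
    filter_upwards [h1, h3] with w hw1 hw3 using ⟨hw1, hw3⟩
  obtain ⟨ε', hε', hball'⟩ := Metric.mem_nhds_iff.mp hnhds
  -- The bound by `r` keeps the parameters `(t, x)` inside the product ball on which `G` is known to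
  -- be injective.
  let ε := min ε' r
  have hε : 0 < ε := lt_min hε' hr
  have hbox : ∀ t ∈ Ioo (-ε) ε, ∀ x ∈ ball x₀ ε, (t, x) ∈ ball w₀ ε := by
    intro t ht x hx
    rw [← ball_prod_same]
    exact ⟨by simpa [Real.ball_eq_Ioo] using ht, hx⟩
  have hball : ∀ w ∈ ball w₀ ε, (w, (0 : C(𝕂, E))) ∈ Φ.target ∧ Φ.symm (w, 0) ∈ ball (w₀, c₀) r :=
    fun w hw => hball' (ball_subset_ball (min_le_left _ _) hw)
  let c : ℝ × E → C(𝕂, E) := fun w => (Φ.symm (w, 0)).2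
  have hc1 : ∀ w ∈ ball w₀ ε, Φ.symm (w, 0) = (w, c w) := by
    intro w hw
    have h := Φ.right_inv (hball w hw).1
    rw [hΦG] at h
    exact Prod.ext (congrArg Prod.fst h : _) rfl
  have hc2 : ∀ w ∈ ball w₀ ε, c w = constMap E w.2 + w.1 • primitiveMap E (Nv (c w)) := by
    intro w hw
    have h := Φ.right_inv (hball w hw).1
    rw [hΦG, hc1 w hw] at h
    have h2 : c w - constMap E w.2 - w.1 • primitiveMap E (Nv (c w)) = 0 := congrArg Prod.snd h
    rw [sub_sub, sub_eq_zero] at h2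
    exact h2
  have hc3 : ∀ w ∈ ball w₀ ε, c w ∈ ball c₀ r := by
    intro w hw
    have h := (hball w hw).2
    rw [hc1 w hw, ← ball_prod_same] at h
    exact h.2
  -- Both curves solve the equation with parameters `(s t, x)`, and the rescaled one takes only
  -- values of `c (t, x)`, so it stays in the ball where solutions are unique.
  have hscale : ∀ t ∈ Ioo (-ε) ε, ∀ x ∈ ball x₀ ε, ∀ s : 𝕂,
      c (s * t, x) = (c (t, x)).comp (scaleMap s) := by
    intro t ht x hx s
    have hst : (s : ℝ) * t ∈ Ioo (-ε) ε := by
      rw [mem_Ioo, ← abs_lt] at ht ⊢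
      rw [abs_mul]
      exact (mul_le_of_le_one_left (abs_nonneg _) (abs_le.mpr s.2)).trans_lt ht
    have hw := hbox _ ht x hx
    have hw' := hbox _ hst x hx
    have hsrc1 : ((↑s * t, x), c (s * t, x)) ∈ Φ.source := by
      rw [← hc1 _ hw']; exact Φ.map_target (hball _ hw').1
    have hsrc2 : ((↑s * t, x), (c (t, x)).comp (scaleMap s)) ∈ Φ.source := by
      refine hrΦ ?_
      rw [← ball_prod_same]
      refine ⟨ball_subset_ball (min_le_right _ _) hw', ?_⟩
      have := hc3 _ hw
      rw [mem_ball, ContinuousMap.dist_lt_iff hr] at this ⊢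
      exact fun τ => this _
    have heq : G ((↑s * t, x), c (s * t, x)) = G ((↑s * t, x), (c (t, x)).comp (scaleMap s)) := by
      refine Prod.ext rfl ?_
      have h1 := hc2 _ hw'
      have h2 := hc2 _ hw
      change c (s * t, x) - constMap E x - (s * t : ℝ) • primitiveMap E (Nv (c (s * t, x))) =
        (c (t, x)).comp (scaleMap s) - constMap E x -
          (s * t : ℝ) • primitiveMap E ((Nv (c (t, x))).comp (scaleMap s))
      ext τ
      have h1' := congrArg (fun f : C(𝕂, E) => f τ) h1
      have h2' := congrArg (fun f : C(𝕂, E) => f (scaleMap s τ)) h2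
      simp only [ContinuousMap.add_apply, ContinuousMap.smul_apply, constMap_apply] at h1' h2'
      simp only [ContinuousMap.sub_apply, ContinuousMap.smul_apply, constMap_apply,
        ContinuousMap.comp_apply]
      rw [mul_comm, mul_smul _ _ (primitiveMap E ((Nv (c (t, x))).comp (scaleMap s)) τ),
        primitiveMap_comp_scaleMap]
      rw [mul_comm] at h1'
      rw [← sub_eq_iff_eq_add'] at h1' h2'
      rw [h1', h2', sub_self, sub_self]
    have := Φ.injOn hsrc1 hsrc2 (by rw [hΦG, hΦG, heq])
    exact congrArg Prod.snd this
  let one : 𝕂 := ⟨1, by simp⟩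
  refine ⟨ε, hε, fun w => c w one, ?_, ?_, ?_⟩
  · have h1 : ContDiffOn ℝ ∞ (fun w : ℝ × E => Φ.symm (w, 0)) (ball w₀ ε) :=
      hΦs.comp (contDiff_id.prodMk contDiff_const).contDiffOn fun w hw => (hball w hw).1
    have h2 := ((ContinuousMap.evalCLM ℝ one).contDiff (n := ∞)).comp_contDiffOn
      ((contDiff_snd (𝕜 := ℝ) (E := ℝ × E) (F := C(𝕂, E))).comp_contDiffOn h1)
    exact h2.mono fun w hw => hbox _ hw.1 _ hw.2
  · intro x hx
    have := hc2 _ (hbox 0 (by simp [hε]) x hx)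
    change c (0, x) one = x
    rw [this]
    simp
  · intro t ht x hx
    rw [mem_Ioo, ← abs_lt] at ht
    -- A reference time strictly between `|t|` and `ε`: every trajectory time `τ` near `t` is then
    -- read off the single curve `c (T, x)` at `τ / T`, where the integral equation can be
    -- differentiated.
    let T := (|t| + ε) / 2
    have hT : |t| < T := by simp only [T]; linarith
    have hTε : T < ε := by simp only [T]; linarith
    have hT0 : 0 < T := (abs_nonneg t).trans_lt hT
    have hT' : T ∈ Ioo (-ε) ε := ⟨by linarith, hTε⟩
    have hmem (τ : ℝ) (hτ : |τ| < T) : τ / T ∈ 𝕂 := by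
      rw [mem_Icc, ← abs_le, abs_div, abs_of_pos hT0, div_le_one hT0]
      exact hτ.le
    have hφ (τ : ℝ) (hτ : |τ| < T) : c (τ, x) one = c (T, x) ⟨τ / T, hmem τ hτ⟩ := by
      have := hscale T hT' x hx ⟨τ / T, hmem τ hτ⟩
      rw [div_mul_cancel₀ _ hT0.ne'] at this
      rw [this, ContinuousMap.comp_apply]
      congr 1
      exact Subtype.ext (mul_one _)
    let g := Nv (c (T, x))
    have hφ' (τ : ℝ) (hτ : |τ| < T) : c (τ, x) one =
        x + T • ∫ u in (0 : ℝ)..(τ / T), IccExtend (neg_le_self zero_le_one) g u := by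
      rw [hφ τ hτ, hc2 _ (hbox _ hT' x hx)]
      rfl
    have hd := ((((continuous_IccExtend g).integral_hasStrictDerivAt 0 (t / T)).hasDerivAt.scomp t
      ((hasDerivAt_id t).div_const T)).const_smul T).const_add x
    have hval : T • (1 / T) • IccExtend (neg_le_self zero_le_one) g (t / T) =
        v (c (t, x) one) := by
      rw [smul_smul, mul_one_div_cancel hT0.ne', one_smul, IccExtend_of_mem _ _ (hmem t hT), hφ t hT]
      rfl
    rw [hval] at hd
    refine hd.congr_of_eventuallyEq ?_
    filter_upwards [(continuous_abs.isOpen_preimage _ isOpen_Iio).mem_nhds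
      (show t ∈ abs ⁻¹' Iio T from hT)] with τ hτ using hφ' τ hτ

end LocalFlow

end NullHorizon

namespace NullHorizon

open Set Metric

/-! ### Flow boxes in a vector space -/

section FlowBox

variable {E : Type*} [NormedAddCommGroup E] [NormedSpace ℝ E] [FiniteDimensional ℝ E]

/-- A flow box in a vector space: coordinates straightening a smooth vector field `v` near a point
of a transverse hyperplane, together with the primitive `I` of a smooth function along the flow
lines which vanishes on the hyperplane. -/
theorem exists_flowBox_vectorSpace {v : E → E} (hv : ContDiff ℝ ∞ v) {g : E → ℝ}
    (hg : ContDiff ℝ ∞ g) {x₀ : E} {H : Submodule ℝ E}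
    (hH : Module.finrank ℝ H + 1 = Module.finrank ℝ E) (hvH : v x₀ ∉ H) {O : Set E}
    (hO : IsOpen O) (hx₀ : x₀ ∈ O) :
    ∃ (Θ : OpenPartialHomeomorph (ℝ × H) E) (ε : ℝ) (I : ℝ × H → ℝ), 0 < ε ∧
      Θ.source = Ioo (-ε) ε ×ˢ ball 0 ε ∧ Θ.target ⊆ O ∧
      (∀ y ∈ ball (0 : H) ε, Θ (0, y) = x₀ + y) ∧
      ContDiffOn ℝ ∞ Θ Θ.source ∧ ContDiffOn ℝ ∞ Θ.symm Θ.target ∧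
      (∀ t ∈ Ioo (-ε) ε, ∀ y ∈ ball (0 : H) ε,
        HasDerivAt (fun s => Θ (s, y)) (v (Θ (t, y))) t) ∧
      ContDiffOn ℝ ∞ I Θ.source ∧ (∀ y ∈ ball (0 : H) ε, I (0, y) = 0) ∧
      (∀ t ∈ Ioo (-ε) ε, ∀ y ∈ ball (0 : H) ε,
        HasDerivAt (fun s => I (s, y)) (g (Θ (t, y))) t) := by
  have hcomplete : CompleteSpace E := FiniteDimensional.complete ℝ E
  -- Adjoining a real coordinate with speed `g` yields the primitive of `g` along the flow, smooth
  -- in all variables, from the same theorem.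
  obtain ⟨ε₀, hε₀, φ, hφ, hφ0, hφd⟩ := exists_local_flow (v := fun p : E × ℝ => (v p.1, g p.1))
    ((hv.comp contDiff_fst).prodMk (hg.comp contDiff_fst)) (x₀, (0 : ℝ))
  let ι : ℝ × H → ℝ × (E × ℝ) := fun p => (p.1, (x₀ + p.2, 0))
  have hι : ContDiff ℝ ∞ ι := contDiff_fst.prodMk
    ((contDiff_const.add (H.subtypeL.contDiff.comp contDiff_snd)).prodMk contDiff_const)
  let A : Set (ℝ × H) := Ioo (-ε₀) ε₀ ×ˢ ball 0 ε₀
  have hA : IsOpen A := isOpen_Ioo.prod isOpen_ball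
  have hιb : ∀ y ∈ ball (0 : H) ε₀, (x₀ + (y : E), (0 : ℝ)) ∈ ball (x₀, (0 : ℝ)) ε₀ := by
    intro y hy
    rw [← ball_prod_same]
    exact ⟨by simpa using hy, by simpa using hε₀⟩
  have hιA : MapsTo ι A (Ioo (-ε₀) ε₀ ×ˢ ball (x₀, (0 : ℝ)) ε₀) :=
    fun p hp => ⟨hp.1, hιb _ hp.2⟩
  let P : ℝ × H → E := fun p => (φ (ι p)).1
  let I : ℝ × H → ℝ := fun p => (φ (ι p)).2
  have hφι : ContDiffOn ℝ ∞ (fun p => φ (ι p)) A := hφ.comp hι.contDiffOn hιA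
  have hP : ContDiffOn ℝ ∞ P A := contDiff_fst.comp_contDiffOn hφι
  have hI : ContDiffOn ℝ ∞ I A := contDiff_snd.comp_contDiffOn hφι
  have hP0 : ∀ y ∈ ball (0 : H) ε₀, P (0, y) = x₀ + y := fun y hy =>
    congrArg Prod.fst (hφ0 _ (hιb y hy))
  have hI0 : ∀ y ∈ ball (0 : H) ε₀, I (0, y) = 0 := fun y hy =>
    congrArg Prod.snd (hφ0 _ (hιb y hy))
  have hPd : ∀ t ∈ Ioo (-ε₀) ε₀, ∀ y ∈ ball (0 : H) ε₀,
      HasDerivAt (fun s => P (s, y)) (v (P (t, y))) t := fun t ht y hy =>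
    (hφd t ht _ (hιb y hy)).fst
  have hId : ∀ t ∈ Ioo (-ε₀) ε₀, ∀ y ∈ ball (0 : H) ε₀,
      HasDerivAt (fun s => I (s, y)) (g (P (t, y))) t := fun t ht y hy =>
    (hφd t ht _ (hιb y hy)).snd
  have h0 : (0 : ℝ) ∈ Ioo (-ε₀) ε₀ := ⟨by linarith, hε₀⟩
  have h0H : (0 : H) ∈ ball (0 : H) ε₀ := mem_ball_self hε₀
  have h00 : ((0 : ℝ), (0 : H)) ∈ A := ⟨h0, h0H⟩
  have hP00 : P (0, 0) = x₀ := by rw [hP0 0 h0H]; simp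
  have hPdiff : HasFDerivAt P (fderiv ℝ P (0, 0)) (0, 0) :=
    ((hP.contDiffAt (hA.mem_nhds h00)).differentiableAt (by simp)).hasFDerivAt
  have hD1 : fderiv ℝ P (0, 0) (1, 0) = v x₀ := by
    have h1 := hPd 0 h0 0 h0H
    rw [hP00] at h1
    have h2 : HasDerivAt (fun s : ℝ => (s, (0 : H))) (1, 0) 0 :=
      (hasDerivAt_id 0).prodMk (hasDerivAt_const _ _)
    have h3 : HasDerivAt (fun s => P (s, 0)) (fderiv ℝ P (0, 0) (1, 0)) 0 :=
      HasFDerivAt.comp_hasDerivAt (l := P) (0 : ℝ) hPdiff h2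
    exact h3.unique h1
  have hD2 (h : H) : fderiv ℝ P (0, 0) (0, h) = h := by
    have h2 : HasFDerivAt (fun y : H => ((0 : ℝ), y)) (ContinuousLinearMap.inr ℝ ℝ H) 0 :=
      (ContinuousLinearMap.inr ℝ ℝ H).hasFDerivAt
    have h3 := HasFDerivAt.comp (0 : H) (g := P) hPdiff h2
    have h4 : HasFDerivAt (fun y : H => x₀ + (y : E)) H.subtypeL 0 :=
      H.subtypeL.hasFDerivAt.const_add x₀
    have h5 := h4.congr_of_eventuallyEq (show (P ∘ fun y : H => ((0 : ℝ), y)) =ᶠ[𝓝 0] _ by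
      filter_upwards [ball_mem_nhds (0 : H) hε₀] with y hy using hP0 y hy)
    exact congrArg (fun L : H →L[ℝ] E => L h) (h3.unique h5)
  -- This map is injective because `v x₀ ∉ H`, and bijective by dimension.
  have hDeq (p : ℝ × H) : fderiv ℝ P (0, 0) p = p.1 • v x₀ + p.2 := by
    rw [← hD1, ← hD2 p.2, ← map_smul, ← map_add]
    simp
  have hinj : Function.Injective (fderiv ℝ P (0, 0)).toLinearMap := by
    refine (injective_iff_map_eq_zero _).mpr fun p hp => ?_
    have hp' : p.1 • v x₀ + (p.2 : E) = 0 := by rw [← hDeq]; exact hp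
    have h1 : p.1 = 0 := by
      by_contra hne
      refine hvH ?_
      have : v x₀ = -(p.1⁻¹ • (p.2 : E)) := by
        rw [eq_neg_iff_add_eq_zero, ← inv_smul_smul₀ hne (v x₀), ← smul_add, hp', smul_zero]
      rw [this]
      exact H.neg_mem (H.smul_mem _ p.2.2)
    rw [h1, zero_smul, zero_add] at hp'
    exact Prod.ext h1 (Subtype.ext hp')
  have hfr : Module.finrank ℝ (ℝ × H) = Module.finrank ℝ E := by
    rw [Module.finrank_prod, Module.finrank_self, ← hH, add_comm]
  let L₀ : (ℝ × H) ≃ₗ[ℝ] E :=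
    LinearMap.linearEquivOfInjective (fderiv ℝ P (0, 0)).toLinearMap hinj hfr
  let L : (ℝ × H) ≃L[ℝ] E := L₀.toContinuousLinearEquiv
  have hL : HasFDerivAt P (L : ℝ × H →L[ℝ] E) (0, 0) := by
    refine hPdiff.congr_fderiv ?_
    ext p <;> rfl
  have hopen : IsOpen (A ∩ P ⁻¹' O) := hP.continuousOn.isOpen_inter_preimage hA hO
  have hcompH : CompleteSpace (ℝ × H) := FiniteDimensional.complete ℝ _
  obtain ⟨Φ, h0Φ, hΦA, hΦP, hΦs⟩ := exists_openPartialHomeomorph_contDiffOn hopen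
    ⟨h00, by rw [mem_preimage, hP00]; exact hx₀⟩ (hP.mono inter_subset_left) hL
  obtain ⟨ε₁, hε₁, hball⟩ := Metric.isOpen_iff.mp Φ.open_source _ h0Φ
  let ε := min ε₀ ε₁
  have hε : 0 < ε := lt_min hε₀ hε₁
  let B : Set (ℝ × H) := Ioo (-ε) ε ×ˢ ball 0 ε
  have hB : IsOpen B := isOpen_Ioo.prod isOpen_ball
  have hBsub : B ⊆ Φ.source := by
    refine Subset.trans ?_ hball
    rw [← ball_prod_same, Real.ball_eq_Ioo]
    refine prod_mono ?_ (ball_subset_ball (min_le_right _ _))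
    rw [zero_sub, zero_add]
    exact Ioo_subset_Ioo (neg_le_neg (min_le_right _ _)) (min_le_right _ _)
  have hIoo : Ioo (-ε) ε ⊆ Ioo (-ε₀) ε₀ :=
    Ioo_subset_Ioo (neg_le_neg (min_le_left _ _)) (min_le_left _ _)
  have hbb : ball (0 : H) ε ⊆ ball 0 ε₀ := ball_subset_ball (min_le_left _ _)
  have hBA : B ⊆ A := prod_mono hIoo hbb
  let Θ := Φ.restrOpen B hB
  have hΘP (x : ℝ × H) : Θ x = P x := hΦP x
  have hΘs : Θ.source = B := by
    rw [Φ.restrOpen_source]; exact inter_eq_right.mpr hBsub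
  have hΘt : Θ.target ⊆ Φ.target := by
    intro x hx
    have h1 := Θ.map_target hx
    rw [hΘs] at h1
    rw [← Θ.right_inv hx]
    exact Φ.map_source (hBsub h1)
  refine ⟨Θ, ε, I, hε, hΘs, ?_, fun y hy => ?_, ?_, hΦs.mono hΘt, fun t ht y hy => ?_, ?_,
    fun y hy => hI0 y (hbb hy), fun t ht y hy => ?_⟩
  · intro x hx
    have h1 := Θ.map_target hx
    rw [hΘs] at h1
    rw [← Θ.right_inv hx, hΘP]
    exact (hΦA (hBsub h1)).2
  · rw [hΘP, hP0 y (hbb hy)]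
  · rw [hΘs]
    exact (hP.mono hBA).congr fun x _ => hΘP x
  · simp only [hΘP]
    exact hPd t (hIoo ht) y (hbb hy)
  · rw [hΘs]
    exact hI.mono hBA
  · rw [hΘP]
    exact hId t (hIoo ht) y (hbb hy)

end FlowBox

end NullHorizon

namespace NullHorizon

open Set Metric Bundle

set_option linter.unusedSectionVars false

/-! ### Cutting off local data -/

section Cutoff

/-- Multiplication by a bump function makes a locally smooth map globally smooth. -/
theorem contDiff_bump_smul {E F : Type*} [NormedAddCommGroup E] [NormedSpace ℝ E]
    [HasContDiffBump E] [FiniteDimensional ℝ E] [NormedAddCommGroup F] [NormedSpace ℝ F]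
    {f : E → F} {s : Set E} (hs : IsOpen s) (hf : ContDiffOn ℝ ∞ f s) {x : E}
    (ψ : ContDiffBump x) (hψ : closedBall x ψ.rOut ⊆ s) : ContDiff ℝ ∞ (fun y => ψ y • f y) := by
  rw [contDiff_iff_contDiffAt]
  intro y
  by_cases hy : y ∈ s
  · exact ψ.contDiff.contDiffAt.smul (hf.contDiffAt (hs.mem_nhds hy))
  · have hy' : y ∉ tsupport ψ := fun h => hy (hψ (by rwa [← ψ.tsupport_eq]))
    refine (contDiffAt_const (c := (0 : F))).congr_of_eventuallyEq ?_
    filter_upwards [notMem_tsupport_iff_eventuallyEq.mp hy'] with z hz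
    rw [hz]; simp

end Cutoff

/-! ### Flow boxes on a manifold -/

section ManifoldFlowBox

variable {d : ℕ} {N : Type*} [TopologicalSpace N] [ChartedSpace (EuclideanSpace ℝ (Fin d)) N]
  [IsManifold (𝓡 d) ∞ N]

local notation "𝔼" => EuclideanSpace ℝ (Fin d)

/-- Coordinates straightening a vector field `X`, together with the primitive of a function `g`
along the flow lines that vanishes on the initial hypersurface. -/
structure FlowBox (X : VField d N) (g : N → ℝ) (H : Submodule ℝ (EuclideanSpace ℝ (Fin d))) where
  coord : OpenPartialHomeomorph (ℝ × H) N
  radius : ℝ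
  prim : ℝ × H → ℝ
  radius_pos : 0 < radius
  source_eq : coord.source = Ioo (-radius) radius ×ˢ ball 0 radius
  smooth : ContMDiffOn 𝓘(ℝ, ℝ × H) (𝓡 d) ∞ coord coord.source
  smooth_symm : ContMDiffOn (𝓡 d) 𝓘(ℝ, ℝ × H) ∞ coord.symm coord.target
  integralCurve : ∀ y ∈ ball (0 : H) radius,
    IsMIntegralCurveOn (I := 𝓡 d) (fun s => coord (s, y)) X (Ioo (-radius) radius)
  prim_smooth : ContDiffOn ℝ ∞ prim coord.source
  prim_zero : ∀ y ∈ ball (0 : H) radius, prim (0, y) = 0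
  hasDerivAt_prim : ∀ t ∈ Ioo (-radius) radius, ∀ y ∈ ball (0 : H) radius,
    HasDerivAt (fun s => prim (s, y)) (g (coord (t, y))) t

/-- The representative of a vector field in a chart. -/
def chartField (X : VField d N) (χ : OpenPartialHomeomorph N 𝔼) (x : 𝔼) : 𝔼 :=
  mfderiv (𝓡 d) (𝓡 d) χ (χ.symm x) (X (χ.symm x))

theorem contDiffOn_chartField {X : VField d N} (hX : IsSmoothField X)
    {χ : OpenPartialHomeomorph N 𝔼} (hχ : χ ∈ IsManifold.maximalAtlas (𝓡 d) ∞ N) :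
    ContDiffOn ℝ ∞ (chartField X χ) χ.target := by
  have h1 := contMDiffOn_of_mem_maximalAtlas hχ
  have h2 := contMDiffOn_symm_of_mem_maximalAtlas hχ
  have h3 := h1.contMDiffOn_tangentMapWithin (m := ∞) (by simp) χ.open_source.uniqueMDiffOn
  have h4 := (ContMDiff.comp_contMDiffOn hX h2)
  have h5 := (contMDiff_snd_tangentBundle_modelSpace 𝔼 𝓘(ℝ, 𝔼) (n := ∞)).comp_contMDiffOn
    (h3.comp h4 fun x hx => χ.map_target hx)
  rw [← contMDiffOn_iff_contDiffOn]
  refine h5.congr fun x hx => ?_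
  have hx' := χ.map_target hx
  exact congrArg (fun L => L (X (χ.symm x)))
    (mfderivWithin_of_isOpen (I := 𝓡 d) (I' := 𝓡 d) (f := χ) χ.open_source hx').symm

theorem mdifferentiable_of_mem_maximalAtlas {χ : OpenPartialHomeomorph N 𝔼}
    (hχ : χ ∈ IsManifold.maximalAtlas (𝓡 d) ∞ N) : χ.MDifferentiable (𝓡 d) (𝓡 d) :=
  ⟨(contMDiffOn_of_mem_maximalAtlas hχ).mdifferentiableOn (by simp),
    (contMDiffOn_symm_of_mem_maximalAtlas hχ).mdifferentiableOn (by simp)⟩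

theorem hasMFDerivAt_chart_symm_comp {X : VField d N} {χ : OpenPartialHomeomorph N 𝔼}
    (hχ : χ ∈ IsManifold.maximalAtlas (𝓡 d) ∞ N) {c : ℝ → 𝔼} {t : ℝ} (ht : c t ∈ χ.target)
    (hc : HasDerivAt c (chartField X χ (c t)) t) :
    HasMFDerivAt 𝓘(ℝ, ℝ) (𝓡 d) (fun s => χ.symm (c s)) t
      ((1 : ℝ →L[ℝ] ℝ).smulRight (X (χ.symm (c t)))) := by
  have hm := mdifferentiable_of_mem_maximalAtlas hχ
  have h1 := (hm.mdifferentiableAt_symm ht).hasMFDerivAt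
  have h2 := HasMFDerivAt.comp t h1 hc.hasFDerivAt.hasMFDerivAt
  refine h2.congr_mfderiv ?_
  ext1
  have h3 := congrArg (fun L => L (X (χ.symm (c t)))) (hm.symm_comp_deriv (χ.map_target ht))
  rw [χ.right_inv ht] at h3
  refine (congrArg (mfderiv (𝓡 d) (𝓡 d) χ.symm (c t))
    (one_smul ℝ (chartField X χ (c t)))).trans (Eq.trans ?_ (one_smul ℝ (X (χ.symm (c t)))).symm)
  exact h3

/-- The vector space flow box needs globally smooth data, so the chart representatives are
multiplied by a bump function. The box is kept inside the ball where the bump equals one, so the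
flow there is the true one. -/
theorem exists_flowBox {X : VField d N} (hX : IsSmoothField X) {g : N → ℝ}
    (hg : IsSmoothFun (d := d) g) {χ : OpenPartialHomeomorph N 𝔼}
    (hχ : χ ∈ IsManifold.maximalAtlas (𝓡 d) ∞ N) {p : N} (hp : p ∈ χ.source)
    {H : Submodule ℝ 𝔼} (hH : Module.finrank ℝ H + 1 = d)
    (hXH : mfderiv (𝓡 d) (𝓡 d) χ p (X p) ∉ H) :
    ∃ B : FlowBox X g H, B.coord (0, 0) = p ∧ B.coord.target ⊆ χ.source ∧
      ∀ y ∈ ball (0 : H) B.radius, χ (B.coord (0, y)) = χ p + y := by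
  have hpt := χ.map_source hp
  obtain ⟨r, hr, hball⟩ := Metric.isOpen_iff.mp χ.open_target _ hpt
  let ψ : ContDiffBump (χ p) := ⟨r / 3, r / 2, by positivity, by linarith⟩
  have hψ : closedBall (χ p) ψ.rOut ⊆ χ.target :=
    (closedBall_subset_ball (by simp only [ψ]; linarith)).trans hball
  have hgχ : ContDiffOn ℝ ∞ (fun x => g (χ.symm x)) χ.target := by
    rw [← contMDiffOn_iff_contDiffOn]
    exact ContMDiff.comp_contMDiffOn hg (contMDiffOn_symm_of_mem_maximalAtlas hχ)
  have hv := contDiff_bump_smul χ.open_target (contDiffOn_chartField hX hχ) ψ hψ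
  have hgψ := contDiff_bump_smul χ.open_target hgχ ψ hψ
  have hψ1 : ∀ x ∈ ball (χ p) ψ.rIn, ψ x = 1 := fun x hx =>
    ψ.one_of_mem_closedBall (ball_subset_closedBall hx)
  have hpO : χ p ∈ ball (χ p) ψ.rIn := mem_ball_self ψ.rIn_pos
  obtain ⟨Θ, ε, I, hε, hs, ht, h0, hΘ, hΘs, hd, hI, hI0, hId⟩ := exists_flowBox_vectorSpace
    hv hgψ (x₀ := χ p) (H := H) (by rw [hH, finrank_euclideanSpace_fin])
    (by
      rw [hψ1 _ hpO, one_smul, chartField]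
      rwa [χ.left_inv hp]) isOpen_ball hpO
  have htt : Θ.target ⊆ χ.target := ht.trans ((ball_subset_ball
    (by simp only [ψ]; linarith)).trans hball)
  have hΘχ : ∀ x ∈ Θ.source, Θ x ∈ χ.target := fun x hx => htt (Θ.map_source hx)
  have hΘψ : ∀ x ∈ Θ.source, ψ (Θ x) = 1 := fun x hx => hψ1 _ (ht (Θ.map_source hx))
  let C := Θ.trans χ.symm
  have hCs : C.source = Θ.source := by
    rw [OpenPartialHomeomorph.trans_source]
    exact inter_eq_left.mpr hΘχ
  have hmem : ∀ t ∈ Ioo (-ε) ε, ∀ y ∈ ball (0 : H) ε, (t, y) ∈ Θ.source := fun t ht y hy => by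
    rw [hs]; exact ⟨ht, hy⟩
  have h00 : (0 : ℝ) ∈ Ioo (-ε) ε := ⟨by linarith, hε⟩
  have hCt : C.target ⊆ χ.source := by
    rw [OpenPartialHomeomorph.trans_target]
    exact inter_subset_left
  refine ⟨⟨C, ε, I, hε, hCs.trans hs, ?_, ?_, fun y hy t ht => ?_, by rwa [hCs], hI0,
    fun t ht y hy => ?_⟩, ?_, hCt, fun y hy => ?_⟩
  · rw [hCs]
    exact (contMDiffOn_symm_of_mem_maximalAtlas hχ).comp (contMDiffOn_iff_contDiffOn.mpr hΘ) hΘχ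
  · refine (contMDiffOn_iff_contDiffOn.mpr hΘs).comp
      ((contMDiffOn_of_mem_maximalAtlas hχ).mono hCt) fun x hx => ?_
    rw [OpenPartialHomeomorph.trans_target] at hx
    exact hx.2
  · have h1 := hd t ht y hy
    rw [hΘψ _ (hmem t ht y hy), one_smul] at h1
    exact (hasMFDerivAt_chart_symm_comp hχ (c := fun s => Θ (s, y)) (hΘχ _ (hmem t ht y hy))
      h1).hasMFDerivWithinAt
  · have h1 := hId t ht y hy
    rw [hΘψ _ (hmem t ht y hy), one_smul] at h1
    exact h1
  · change χ.symm (Θ (0, 0)) = p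
    rw [h0 0 (mem_ball_self hε)]
    simp [χ.left_inv hp]
  · change χ (χ.symm (Θ (0, y))) = _
    rw [χ.right_inv (hΘχ _ (hmem 0 h00 y hy)), h0 y hy]

end ManifoldFlowBox

end NullHorizon

namespace NullHorizon

open Set Metric Bundle

set_option linter.unusedSectionVars false

/-! ### Integral curves and integrals along them -/

section Flow

variable {d : ℕ} {N : Type*} [TopologicalSpace N] [ChartedSpace (EuclideanSpace ℝ (Fin d)) N]
  [IsManifold (𝓡 d) ∞ N]

local notation "𝔼" => EuclideanSpace ℝ (Fin d)

theorem IsSmoothField.contMDiff_one {X : VField d N} (hX : IsSmoothField X) :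
    ContMDiff (𝓡 d) (𝓡 d).tangent 1 (fun p => (⟨p, X p⟩ : TangentBundle (𝓡 d) N)) :=
  ContMDiff.of_le hX (by simp)

theorem isManifold_one_of_infty : IsManifold (𝓡 d) 1 N :=
  IsManifold.of_le (n := ∞) (by simp)

/-- The chain rule along an integral curve. -/
theorem hasDerivAt_comp_integralCurve {X : VField d N} {c : ℝ → N} {f : N → ℝ} {a b t : ℝ}
    (hc : IsMIntegralCurveOn (I := 𝓡 d) c X (Ioo a b)) (ht : t ∈ Ioo a b)
    (hf : MDifferentiableAt (𝓡 d) 𝓘(ℝ, ℝ) f (c t)) :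
    HasDerivAt (fun s => f (c s)) (dir X f (c t)) t := by
  have h1 := (hc t ht).hasMFDerivAt (isOpen_Ioo.mem_nhds ht)
  have h2 : HasFDerivAt (fun s => f (c s)) (_ : ℝ →L[ℝ] ℝ) t := (hf.hasMFDerivAt.comp t h1).hasFDerivAt
  refine h2.hasDerivAt.congr_deriv ?_
  exact congrArg (mfderiv (𝓡 d) 𝓘(ℝ, ℝ) f (c t)) (one_smul ℝ (X (c t)))

theorem exists_isMIntegralCurveOn_Ioo {X : VField d N} (hX : IsSmoothField X) (p : N) :
    ∃ (c : ℝ → N) (ε : ℝ), 0 < ε ∧ c 0 = p ∧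
      IsMIntegralCurveOn (I := 𝓡 d) c X (Ioo (-ε) ε) := by
  have := isManifold_one_of_infty (d := d) (N := N)
  obtain ⟨c, hc0, hc⟩ := exists_isMIntegralCurveAt_of_contMDiffAt_boundaryless 0
    (hX.contMDiff_one p)
  obtain ⟨ε, hε, h⟩ := isMIntegralCurveAt_iff'.mp hc
  rw [Real.ball_eq_Ioo, zero_sub, zero_add] at h
  exact ⟨c, ε, hε, hc0, h⟩

theorem flowsTo_zero {X : VField d N} (hX : IsSmoothField X) (p : N) : FlowsTo X p 0 p := by
  obtain ⟨c, ε, hε, hc0, hc⟩ := exists_isMIntegralCurveOn_Ioo hX p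
  exact ⟨c, -ε, ε, ⟨by linarith, hε⟩, ⟨by linarith, hε⟩, hc, hc0, hc0⟩

theorem FlowsTo.eq_of_dir_eq_zero {X : VField d N} {p q : N} {t : ℝ} (h : FlowsTo X p t q)
    {f : N → ℝ} (hf : IsSmoothFun (d := d) f) (hf0 : ∀ p, dir X f p = 0) : f q = f p := by
  obtain ⟨c, a, b, h0, ht, hc, rfl, rfl⟩ := h
  exact (convex_Ioo a b).is_const_of_fderivWithin_eq_zero (𝕜 := ℝ) (f := fun s => f (c s))
    (fun s hs => (hasDerivAt_comp_integralCurve hc hs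
      (hf.mdifferentiableAt _)).differentiableAt.differentiableWithinAt)
    (fun s hs => by
      have h1 := hasDerivAt_comp_integralCurve hc hs (hf.mdifferentiableAt _)
      rw [hf0] at h1
      rw [fderivWithin_of_isOpen isOpen_Ioo hs, h1.hasFDerivAt.fderiv]
      ext; simp) ht h0

variable [T2Space N]

theorem eqOn_integralCurve {X : VField d N} (hX : IsSmoothField X) {c c' : ℝ → N}
    {a b a' b' s : ℝ} (hc : IsMIntegralCurveOn (I := 𝓡 d) c X (Ioo a b))
    (hc' : IsMIntegralCurveOn (I := 𝓡 d) c' X (Ioo a' b')) (hs : s ∈ Ioo a b)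
    (hs' : s ∈ Ioo a' b') (h : c s = c' s) : EqOn c c' (Ioo (max a a') (min b b')) := by
  have := isManifold_one_of_infty (d := d) (N := N)
  exact isMIntegralCurveOn_Ioo_eqOn_of_contMDiff_boundaryless
    ⟨max_lt hs.1 hs'.1, lt_min hs.2 hs'.2⟩ hX.contMDiff_one
    (hc.mono (Ioo_subset_Ioo (le_max_left _ _) (min_le_left _ _)))
    (hc'.mono (Ioo_subset_Ioo (le_max_right _ _) (min_le_right _ _))) h

/-- The integral curve of `X` from `p` reaches `q` at parameter `t`, and the integral of `g` along
it is `x`. -/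
def FlowsWith (X : VField d N) (g : N → ℝ) (p : N) (t : ℝ) (q : N) (x : ℝ) : Prop :=
  ∃ (c : ℝ → N) (a b : ℝ), 0 ∈ Ioo a b ∧ t ∈ Ioo a b ∧
    IsMIntegralCurveOn (I := 𝓡 d) c X (Ioo a b) ∧ c 0 = p ∧ c t = q ∧ ∫ s in (0)..t, g (c s) = x

theorem flowsTo_iff_exists_flowsWith {X : VField d N} (g : N → ℝ) {p q : N} {t : ℝ} :
    FlowsTo X p t q ↔ ∃ x, FlowsWith X g p t q x :=
  ⟨fun ⟨c, a, b, h0, ht, hc, hp, hq⟩ => ⟨_, c, a, b, h0, ht, hc, hp, hq, rfl⟩,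
    fun ⟨_, c, a, b, h0, ht, hc, hp, hq, _⟩ => ⟨c, a, b, h0, ht, hc, hp, hq⟩⟩

theorem uIcc_subset_Ioo {a b s t : ℝ} (hs : s ∈ Ioo a b) (ht : t ∈ Ioo a b) :
    uIcc s t ⊆ Ioo a b :=
  ordConnected_Ioo.uIcc_subset hs ht

theorem FlowsWith.unique {X : VField d N} (hX : IsSmoothField X) {g : N → ℝ} {p q q' : N}
    {t x x' : ℝ} (h : FlowsWith X g p t q x) (h' : FlowsWith X g p t q' x') :
    q = q' ∧ x = x' := by
  obtain ⟨c, a, b, h0, ht, hc, hp, rfl, rfl⟩ := h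
  obtain ⟨c', a', b', h0', ht', hc', hp', rfl, rfl⟩ := h'
  have he := eqOn_integralCurve hX hc hc' h0 h0' (hp.trans hp'.symm)
  have h0m : (0 : ℝ) ∈ Ioo (max a a') (min b b') := ⟨max_lt h0.1 h0'.1, lt_min h0.2 h0'.2⟩
  have htm : t ∈ Ioo (max a a') (min b b') := ⟨max_lt ht.1 ht'.1, lt_min ht.2 ht'.2⟩
  refine ⟨he htm, intervalIntegral.integral_congr fun s hs => ?_⟩
  simp only [he (uIcc_subset_Ioo h0m htm hs)]

/-- The base point of a flow line can be moved along any integral curve through it. -/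
theorem FlowsWith.shift {X : VField d N} (hX : IsSmoothField X) {g : N → ℝ}
    (hg : Continuous g) {c : ℝ → N} {a b s₁ s₂ t x : ℝ} {q : N}
    (hc : IsMIntegralCurveOn (I := 𝓡 d) c X (Ioo a b)) (hs₁ : s₁ ∈ Ioo a b) (hs₂ : s₂ ∈ Ioo a b)
    (h : FlowsWith X g (c s₁) t q x) :
    FlowsWith X g (c s₂) (t + s₁ - s₂) q (x + ∫ s in s₂..s₁, g (c s)) := by
  have := isManifold_one_of_infty (d := d) (N := N)
  obtain ⟨c', a', b', h0', ht', hc', hp', rfl, rfl⟩ := h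
  have h1 := hc'.comp_add (-s₁)
  have e1 : {s | s + -s₁ ∈ Ioo a' b'} = Ioo (a' + s₁) (b' + s₁) := by
    ext s; simp only [mem_ofPred_eq, mem_Ioo]; constructor <;> rintro ⟨_, _⟩ <;> constructor <;> linarith
  rw [e1] at h1
  have hm : s₁ ∈ Ioo (a' + s₁) (b' + s₁) := ⟨by linarith [h0'.1], by linarith [h0'.2]⟩
  have htm : t + s₁ ∈ Ioo (a' + s₁) (b' + s₁) := ⟨by linarith [ht'.1], by linarith [ht'.2]⟩
  have hcc : (c' ∘ fun s => s + -s₁) s₁ = c s₁ := by simp [hp']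
  classical
  -- The curve reaching `q`, shifted to pass through `c s₁` at time `s₁`, is glued to `c` by
  -- uniqueness; translating the result by `s₂` starts it at `c s₂`.
  set γ := piecewise (Ioo (a' + s₁) (b' + s₁)) (c' ∘ fun s => s + -s₁) c with hγ
  have h2 : IsMIntegralCurveOn (I := 𝓡 d) γ X (Ioo (a' + s₁) (b' + s₁) ∪ Ioo a b) :=
    isMIntegralCurveOn_piecewise hX.contMDiff_one h1 hc ⟨hm, hs₁⟩ hcc
  have h3 : EqOn γ c (Ioo a b) :=
    eqOn_piecewise_of_isMIntegralCurveOn_Ioo hX.contMDiff_one h1 hc ⟨hm, hs₁⟩ hcc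
  have h4 : EqOn γ (c' ∘ fun s => s + -s₁) (Ioo (a' + s₁) (b' + s₁)) := piecewise_eqOn _ _ _
  have hu : Ioo (a' + s₁) (b' + s₁) ∪ Ioo a b = Ioo (min (a' + s₁) a) (max (b' + s₁) b) :=
    Ioo_union_Ioo' (hs₁.1.trans hm.2) (hm.1.trans hs₁.2)
  rw [hu] at h2
  have hI : Ioo a b ⊆ Ioo (min (a' + s₁) a) (max (b' + s₁) b) := hu ▸ subset_union_right
  have hI' : Ioo (a' + s₁) (b' + s₁) ⊆ Ioo (min (a' + s₁) a) (max (b' + s₁) b) :=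
    hu ▸ subset_union_left
  have h5 := h2.comp_add s₂
  have e2 : {s | s + s₂ ∈ Ioo (min (a' + s₁) a) (max (b' + s₁) b)} =
      Ioo (min (a' + s₁) a - s₂) (max (b' + s₁) b - s₂) := by
    ext s
    simp only [mem_ofPred_eq, mem_Ioo]
    constructor <;> rintro ⟨_, _⟩ <;> constructor <;> linarith
  rw [e2] at h5
  have hint : ∀ u v, u ∈ Ioo (min (a' + s₁) a) (max (b' + s₁) b) →
      v ∈ Ioo (min (a' + s₁) a) (max (b' + s₁) b) →
      IntervalIntegrable (fun s => g (γ s)) MeasureTheory.volume u v := fun u v hu hv =>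
    (hg.comp_continuousOn (h2.continuousOn.mono (uIcc_subset_Ioo hu hv))).intervalIntegrable
  refine ⟨_, _, _, ?_, ?_, h5, ?_, ?_, ?_⟩
  · have := hI hs₂
    exact ⟨by linarith [this.1], by linarith [this.2]⟩
  · have := hI' htm
    exact ⟨by linarith [this.1], by linarith [this.2]⟩
  · simp [h3 hs₂]
  · simp only [Function.comp_apply, sub_add_cancel]
    rw [h4 htm]
    simp
  · have i1 : ∫ s in (0)..(t + s₁ - s₂), g ((γ ∘ fun s => s + s₂) s) =
        ∫ s in s₂..(t + s₁), g (γ s) := by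
      have := intervalIntegral.integral_comp_add_right (a := 0) (b := t + s₁ - s₂)
        (fun s => g (γ s)) s₂
      simpa using this
    have i2 : ∫ s in s₁..(t + s₁), g (γ s) = ∫ s in (0)..t, g (c' s) := by
      have := intervalIntegral.integral_comp_add_right (a := 0) (b := t) (fun s => g (γ s)) s₁
      rw [zero_add] at this
      rw [← this]
      refine intervalIntegral.integral_congr fun s hs => ?_
      have hs' := uIcc_subset_Ioo h0' ht' hs
      have := h4 (show s + s₁ ∈ Ioo (a' + s₁) (b' + s₁) from
        ⟨by linarith [hs'.1], by linarith [hs'.2]⟩)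
      simp [this]
    have i3 : ∫ s in s₂..s₁, g (γ s) = ∫ s in s₂..s₁, g (c s) :=
      intervalIntegral.integral_congr fun s hs => by
        simp only [h3 (uIcc_subset_Ioo hs₂ hs₁ hs)]
    rw [i1, ← intervalIntegral.integral_add_adjacent_intervals (hint _ _ (hI hs₂) (hI hs₁))
      (hint _ _ (hI hs₁) (hI' htm)), i2, i3, add_comm]

end Flow

end NullHorizon

namespace NullHorizon

open Set Metric Bundle

set_option linter.unusedSectionVars false

/-! ### The transport equation `n(u) = g` -/

section Transport

variable {d : ℕ} {N : Type*} [TopologicalSpace N] [ChartedSpace (EuclideanSpace ℝ (Fin d)) N]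
  [IsManifold (𝓡 d) ∞ N]

local notation "𝔼" => EuclideanSpace ℝ (Fin d)

theorem exists_hyperplane_notMem {v : 𝔼} (hv : v ≠ 0) :
    ∃ H : Submodule ℝ 𝔼, Module.finrank ℝ H + 1 = d ∧ v ∉ H := by
  refine ⟨(ℝ ∙ v)ᗮ, ?_, fun h => ?_⟩
  · have := (ℝ ∙ v).finrank_add_finrank_orthogonal
    rw [finrank_span_singleton hv, finrank_euclideanSpace_fin] at this
    omega
  · exact hv (inner_self_eq_zero (𝕜 := ℝ).mp (Submodule.mem_orthogonal_singleton_iff_inner_right.mp h))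

theorem exists_flowBox_of_ne_zero {X : VField d N} (hX : IsSmoothField X) {g : N → ℝ}
    (hg : IsSmoothFun (d := d) g) {p : N} (hp : X p ≠ 0) :
    ∃ (H : Submodule ℝ 𝔼) (B : FlowBox X g H), B.coord (0, 0) = p := by
  have hχ : chartAt 𝔼 p ∈ IsManifold.maximalAtlas (𝓡 d) ∞ N :=
    IsManifold.chart_mem_maximalAtlas p
  have hm := mdifferentiable_of_mem_maximalAtlas hχ
  have hv : mfderiv (𝓡 d) (𝓡 d) (chartAt 𝔼 p) p (X p) ≠ 0 := fun h =>
    hp (hm.mfderiv_injective (mem_chart_source _ p) (h.trans (map_zero _).symm))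
  obtain ⟨H, hH, hvH⟩ := exists_hyperplane_notMem hv
  obtain ⟨B, hB, -⟩ := exists_flowBox hX hg hχ (mem_chart_source _ p) hH hvH
  exact ⟨H, B, hB⟩

namespace FlowBox

variable {X : VField d N} {g : N → ℝ} {H : Submodule ℝ (EuclideanSpace ℝ (Fin d))}
  (B : FlowBox X g H)

theorem mem_source {t : ℝ} {y : H} (ht : t ∈ Ioo (-B.radius) B.radius)
    (hy : y ∈ ball 0 B.radius) : (t, y) ∈ B.coord.source := by
  rw [B.source_eq]; exact ⟨ht, hy⟩

theorem zero_mem : (0 : ℝ) ∈ Ioo (-B.radius) B.radius :=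
  ⟨neg_lt_zero.mpr B.radius_pos, B.radius_pos⟩

theorem zero_mem_ball : (0 : H) ∈ ball (0 : H) B.radius := mem_ball_self B.radius_pos

theorem symm_mem {q : N} (hq : q ∈ B.coord.target) :
    (B.coord.symm q).1 ∈ Ioo (-B.radius) B.radius ∧ (B.coord.symm q).2 ∈ ball 0 B.radius := by
  have := B.coord.map_target hq
  rwa [B.source_eq] at this

theorem contMDiffOn_prim : ContMDiffOn (𝓡 d) 𝓘(ℝ, ℝ) ∞ (fun q => B.prim (B.coord.symm q))
    B.coord.target :=
  (contMDiffOn_iff_contDiffOn.mpr B.prim_smooth).comp B.smooth_symm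
    fun _ hq => B.coord.map_target hq

/-- If `u` differs from the primitive by a function constant along the flow lines, then smoothness
of `u` propagates along the central flow line. -/
theorem eventually_contMDiffAt_of_eventually {u : N → ℝ}
    (hu : ∀ y ∈ ball (0 : H) B.radius, ∀ t ∈ Ioo (-B.radius) B.radius,
      ∀ t' ∈ Ioo (-B.radius) B.radius,
      u (B.coord (t', y)) - u (B.coord (t, y)) = B.prim (t', y) - B.prim (t, y))
    {t t' : ℝ} (ht : t ∈ Ioo (-B.radius) B.radius) (ht' : t' ∈ Ioo (-B.radius) B.radius)
    (h : ∀ᶠ q in 𝓝 (B.coord (t, 0)), ContMDiffAt (𝓡 d) 𝓘(ℝ, ℝ) ∞ u q) :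
    ∀ᶠ q in 𝓝 (B.coord (t', 0)), ContMDiffAt (𝓡 d) 𝓘(ℝ, ℝ) ∞ u q := by
  have hmem := B.mem_source ht' B.zero_mem_ball
  have hsec : ContMDiff 𝓘(ℝ, ℝ × H) 𝓘(ℝ, ℝ × H) ∞ (fun z : ℝ × H => (t, z.2)) :=
    (contDiff_const.prodMk contDiff_snd).contMDiff
  -- Sliding each point along its flow line to time `t` writes `u` as `u ∘ T` plus a difference of
  -- values of `prim`, smooth wherever `u` is smooth near the slice.
  let T : N → N := fun q => B.coord (t, (B.coord.symm q).2)
  have hT : ContMDiffOn (𝓡 d) (𝓡 d) ∞ T B.coord.target :=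
    B.smooth.comp (hsec.comp_contMDiffOn B.smooth_symm) fun q hq =>
      B.mem_source ht (B.symm_mem hq).2
  have hnhds : B.coord.target ∈ 𝓝 (B.coord (t', 0)) :=
    B.coord.open_target.mem_nhds (B.coord.map_source hmem)
  have hTt : T (B.coord (t', 0)) = B.coord (t, 0) := by
    simp only [T]; rw [B.coord.left_inv hmem]
  have hev : ∀ᶠ q in 𝓝 (B.coord (t', 0)), ContMDiffAt (𝓡 d) 𝓘(ℝ, ℝ) ∞ u (T q) := by
    have hc := (hT.contMDiffAt hnhds).continuousAt
    rw [ContinuousAt, hTt] at hc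
    exact hc.eventually h
  filter_upwards [hev, hnhds] with q hq hqt
  have hqn := B.coord.open_target.mem_nhds hqt
  have h1 : ContMDiffAt (𝓡 d) 𝓘(ℝ, ℝ) ∞
      (fun q => u (T q) + (B.prim (B.coord.symm q) - B.prim (t, (B.coord.symm q).2))) q := by
    refine (ContMDiffAt.comp q hq (hT.contMDiffAt hqn)).add
      ((B.contMDiffOn_prim.contMDiffAt hqn).sub ?_)
    exact (((contMDiffOn_iff_contDiffOn.mpr B.prim_smooth).comp
      (hsec.comp_contMDiffOn B.smooth_symm) fun q hq =>
        B.mem_source ht (B.symm_mem hq).2).contMDiffAt hqn)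
  refine h1.congr_of_eventuallyEq ?_
  filter_upwards [hqn] with q' hq'
  have h2 := hu _ (B.symm_mem hq').2 t ht _ (B.symm_mem hq').1
  simp only [Prod.mk.eta, B.coord.right_inv hq'] at h2
  simp only [T]
  linarith

end FlowBox

variable {X : VField d N} {g u : N → ℝ}

/-- `u` increases along every integral curve of `X` by the integral of `g`. -/
def IsPrimitive (X : VField d N) (g u : N → ℝ) : Prop :=
  ∀ (c : ℝ → N) (a b : ℝ), IsMIntegralCurveOn (I := 𝓡 d) c X (Ioo a b) →
    ∀ s ∈ Ioo a b, ∀ t ∈ Ioo a b, u (c t) - u (c s) = ∫ r in s..t, g (c r)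

theorem IsPrimitive.flowBox (hu : IsPrimitive X g u) (hg : Continuous g)
    {H : Submodule ℝ 𝔼} (B : FlowBox X g H) {y : H} (hy : y ∈ ball 0 B.radius) {t t' : ℝ}
    (ht : t ∈ Ioo (-B.radius) B.radius) (ht' : t' ∈ Ioo (-B.radius) B.radius) :
    u (B.coord (t', y)) - u (B.coord (t, y)) = B.prim (t', y) - B.prim (t, y) := by
  have hc := B.integralCurve y hy
  rw [hu _ _ _ hc t ht t' ht']
  have hsub := uIcc_subset_Ioo ht ht'
  exact intervalIntegral.integral_eq_sub_of_hasDerivAt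
    (fun s hs => B.hasDerivAt_prim s (hsub hs) y hy)
    (hg.comp_continuousOn (hc.continuousOn.mono hsub)).intervalIntegrable

theorem IsPrimitive.dir_eq (hX : IsSmoothField X) (hu : IsPrimitive X g u)
    (hus : IsSmoothFun (d := d) u) (hg : Continuous g) (p : N) : dir X u p = g p := by
  obtain ⟨c, ε, hε, rfl, hc⟩ := exists_isMIntegralCurveOn_Ioo hX p
  have h0 : (0 : ℝ) ∈ Ioo (-ε) ε := ⟨by linarith, hε⟩
  have h1 := hasDerivAt_comp_integralCurve hc h0 (hus.mdifferentiableAt _)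
  have hcont : ContinuousOn (fun r => g (c r)) (Ioo (-ε) ε) := hg.comp_continuousOn hc.continuousOn
  have h2 : HasDerivAt (fun t => ∫ r in (0)..t, g (c r)) (g (c 0)) 0 :=
    intervalIntegral.integral_hasDerivAt_right (by simp)
      (hcont.stronglyMeasurableAtFilter isOpen_Ioo _ h0) (hcont.continuousAt (isOpen_Ioo.mem_nhds h0))
  refine h1.unique ((h2.const_add (u (c 0))).congr_of_eventuallyEq ?_)
  filter_upwards [isOpen_Ioo.mem_nhds h0] with t ht
  have := hu c _ _ hc 0 h0 t ht
  linarith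

variable [T2Space N]

/-- The set of parameters of an integral curve near which a primitive is smooth is open and
closed. -/
theorem IsPrimitive.eventually_contMDiffAt_iff (hX : IsSmoothField X) (hX0 : ∀ p, X p ≠ 0)
    (hu : IsPrimitive X g u) (hg : IsSmoothFun (d := d) g) {c : ℝ → N} {a b : ℝ}
    (hc : IsMIntegralCurveOn (I := 𝓡 d) c X (Ioo a b)) {s t : ℝ} (hs : s ∈ Ioo a b)
    (ht : t ∈ Ioo a b) :
    (∀ᶠ q in 𝓝 (c s), ContMDiffAt (𝓡 d) 𝓘(ℝ, ℝ) ∞ u q) ↔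
      ∀ᶠ q in 𝓝 (c t), ContMDiffAt (𝓡 d) 𝓘(ℝ, ℝ) ∞ u q := by
  have hgc : Continuous g := ContMDiff.continuous hg
  -- The relation is symmetric and transitive, so connectedness of the interval reduces it to
  -- parameters near `s`, all inside one flow box around `c s`.
  refine isPreconnected_Ioo.induction₂ (fun s t =>
    (∀ᶠ q in 𝓝 (c s), ContMDiffAt (𝓡 d) 𝓘(ℝ, ℝ) ∞ u q) ↔
      ∀ᶠ q in 𝓝 (c t), ContMDiffAt (𝓡 d) 𝓘(ℝ, ℝ) ∞ u q) (fun s hs => ?_)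
    (fun _ _ _ _ _ _ => Iff.trans) (fun _ _ _ _ => Iff.symm) hs ht
  obtain ⟨H, B, hB⟩ := exists_flowBox_of_ne_zero hX hg (hX0 (c s))
  have h1 := (B.integralCurve 0 B.zero_mem_ball).comp_add (-s)
  have e1 : {r | r + -s ∈ Ioo (-B.radius) B.radius} = Ioo (-B.radius + s) (B.radius + s) := by
    ext r
    simp only [mem_ofPred_eq, mem_Ioo]
    constructor <;> rintro ⟨_, _⟩ <;> constructor <;> linarith
  rw [e1] at h1
  have hm : s ∈ Ioo (-B.radius + s) (B.radius + s) :=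
    ⟨by linarith [B.radius_pos], by linarith [B.radius_pos]⟩
  have he := eqOn_integralCurve hX hc h1 hs hm (by simp [hB])
  have hn : Ioo (max a (-B.radius + s)) (min b (B.radius + s)) ∈ 𝓝 s :=
    isOpen_Ioo.mem_nhds ⟨max_lt hs.1 hm.1, lt_min hs.2 hm.2⟩
  filter_upwards [mem_nhdsWithin_of_mem_nhds hn] with t ht
  have ht' : t + -s ∈ Ioo (-B.radius) B.radius :=
    ⟨by linarith [le_max_right a (-B.radius + s), ht.1],
      by linarith [min_le_right b (B.radius + s), ht.2]⟩
  have hct : c t = B.coord (t + -s, 0) := he ht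
  rw [hct, ← hB]
  have hu' : ∀ y ∈ ball (0 : H) B.radius, ∀ t ∈ Ioo (-B.radius) B.radius,
      ∀ t' ∈ Ioo (-B.radius) B.radius,
      u (B.coord (t', y)) - u (B.coord (t, y)) = B.prim (t', y) - B.prim (t, y) :=
    fun y hy t ht t' ht' => hu.flowBox hgc B hy ht ht'
  exact ⟨B.eventually_contMDiffAt_of_eventually hu' B.zero_mem ht',
    B.eventually_contMDiffAt_of_eventually hu' ht' B.zero_mem⟩

/-- On a manifold ruled by the generators through a cross-section, the transport equation
`n(u) = g` has a global solution. -/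
theorem NullMetricData.IsCrossSection.exists_dir_n_eq {D : NullMetricData d N} {S : Set N}
    (hS : D.IsCrossSection S) {g : N → ℝ} (hg : IsSmoothFun (d := d) g) :
    ∃ u : N → ℝ, IsSmoothFun (d := d) u ∧ ∀ p, dir D.n u p = g p := by
  have hX := D.isSmoothField_n
  have hgc : Continuous g := ContMDiff.continuous hg
  have hex : ∀ p, ∃ t q x, q ∈ S ∧ FlowsWith D.n g p t q x := fun p => by
    obtain ⟨t, ⟨q, hq, hf⟩, -⟩ := hS.2 p
    obtain ⟨x, hx⟩ := (flowsTo_iff_exists_flowsWith g).mp hf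
    exact ⟨t, q, x, hq, hx⟩
  -- `v p` is the integral of `g` from `p` to the foot of its generator on `S`. It is well defined
  -- since `S` is met at a single parameter. The solution is `-v`, as moving forward along `n`
  -- shortens this integral.
  choose τ foot v hfoot hv using hex
  have huniq : ∀ p t q x, q ∈ S → FlowsWith D.n g p t q x → v p = x := by
    intro p t q x hq hf
    have htt := (hS.2 p).unique ⟨_, hfoot p, (flowsTo_iff_exists_flowsWith g).mpr ⟨_, hv p⟩⟩
      ⟨q, hq, (flowsTo_iff_exists_flowsWith g).mpr ⟨_, hf⟩⟩
    have h1 := hv p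
    rw [htt] at h1
    exact (h1.unique hX hf).2
  have hu : IsPrimitive D.n g (fun p => - v p) := by
    intro c a b hc s hs t ht
    have h1 := huniq _ _ _ _ (hfoot (c t)) ((hv (c t)).shift hX hgc hc ht hs)
    linarith
  have hsmooth : IsSmoothFun (d := d) (fun p => - v p) := by
    intro p
    obtain ⟨c, a, b, h0, ht, hc, rfl, hcq, -⟩ := hv p
    -- It suffices to have smoothness near the foot. There a flow box starting on `S` has `v = 0` on
    -- its initial slice, so `-v` is the box's smooth primitive.
    refine ((hu.eventually_contMDiffAt_iff hX D.n_ne_zero hg hc h0 ht).mpr ?_).self_of_nhds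
    rw [hcq]
    obtain ⟨χ, hχ, hqχ, H, hH, hSH, hnH⟩ := hS.1 _ (hfoot (c 0))
    obtain ⟨B, hB, hBt, hB0⟩ := exists_flowBox hX hg hχ hqχ hH hnH
    have hBS : ∀ y ∈ ball (0 : H) B.radius, v (B.coord (0, y)) = 0 := fun y hy => by
      have hm := B.coord.map_source (B.mem_source B.zero_mem hy)
      have hmem : B.coord (0, y) ∈ S := by
        rw [hSH _ (hBt hm), hB0 y hy]
        exact H.add_mem ((hSH _ hqχ).mp (hfoot _)) y.2
      obtain ⟨c', a', b', h0', ht', hc', hp', hq'⟩ := flowsTo_zero hX (B.coord (0, y))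
      exact huniq _ 0 _ _ hmem ⟨c', a', b', h0', ht', hc', hp', hq', by simp⟩
    have hmem := B.coord.map_source (B.mem_source B.zero_mem B.zero_mem_ball)
    rw [hB] at hmem
    filter_upwards [B.coord.open_target.mem_nhds hmem] with q hq
    have hqn := B.coord.open_target.mem_nhds hq
    refine (B.contMDiffOn_prim.contMDiffAt hqn).congr_of_eventuallyEq ?_
    filter_upwards [hqn] with q' hq'
    have h1 := hu.flowBox hgc B (B.symm_mem hq').2 B.zero_mem (B.symm_mem hq').1
    simp only [Prod.mk.eta, B.coord.right_inv hq'] at h1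
    rw [hBS _ (B.symm_mem hq').2, B.prim_zero _ (B.symm_mem hq').2] at h1
    linarith
  exact ⟨_, hsmooth, hu.dir_eq hX hsmooth hgc⟩

end Transport

end NullHorizon

namespace NullHorizon

open Set Metric Bundle

set_option linter.unusedSectionVars false

/-! ### Charts flattening a regular zero set -/

section AdaptedChart

variable {d : ℕ} {N : Type*} [TopologicalSpace N] [ChartedSpace (EuclideanSpace ℝ (Fin d)) N]
  [IsManifold (𝓡 d) ∞ N]

local notation "𝔼" => EuclideanSpace ℝ (Fin d)

theorem dir_eq_of_eventuallyEq_comp {X : VField d N} {a : N → ℝ} {φ : OpenPartialHomeomorph N 𝔼}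
    (hφ : φ ∈ IsManifold.maximalAtlas (𝓡 d) ∞ N) {F : 𝔼 → ℝ} {q : N} (hq : q ∈ φ.source)
    {L : 𝔼 →L[ℝ] ℝ} (hF : HasFDerivAt F L (φ q)) (h : ∀ᶠ x in 𝓝 q, a x = F (φ x)) :
    dir X a q = L (mfderiv (𝓡 d) (𝓡 d) φ q (X q)) := by
  have h1 := ((mdifferentiable_of_mem_maximalAtlas hφ).mdifferentiableAt hq).hasMFDerivAt
  have h2 := (HasMFDerivAt.comp q hF.hasMFDerivAt h1).congr_of_eventuallyEq h
  exact congrArg (fun M => M (X q)) h2.mfderiv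

/-- A chart in which the zero set of a function with nonvanishing derivative along `X` is a slice
of a hyperplane. -/
theorem exists_adapted_chart {X : VField d N} {a : N → ℝ} (ha : IsSmoothFun (d := d) a) {p : N}
    (hp : a p = 0) (hXa : dir X a p ≠ 0) {O : Set N} (hO : IsOpen O) (hpO : p ∈ O) :
    ∃ φ ∈ IsManifold.maximalAtlas (𝓡 d) ∞ N, p ∈ φ.source ∧ φ.source ⊆ O ∧
      ∃ H : Submodule ℝ 𝔼, Module.finrank ℝ H + 1 = d ∧
        (∀ q ∈ φ.source, a q = 0 ↔ φ q ∈ H) ∧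
        (∀ q ∈ φ.source, dir X a q ≠ 0 → mfderiv (𝓡 d) (𝓡 d) φ q (X q) ∉ H) ∧
        IsConnected ({q | a q = 0} ∩ φ.source) := by
  set φ₀ := chartAt 𝔼 p with hφ₀
  have hφ₀a : φ₀ ∈ IsManifold.maximalAtlas (𝓡 d) ∞ N := IsManifold.chart_mem_maximalAtlas p
  have hp₀ : p ∈ φ₀.source := mem_chart_source _ p
  set x₀ := φ₀ p with hx₀
  have hx₀t : x₀ ∈ φ₀.target := φ₀.map_source hp₀
  let F : 𝔼 → ℝ := fun x => a (φ₀.symm x)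
  have hF : ContDiffOn ℝ ∞ F φ₀.target := by
    rw [← contMDiffOn_iff_contDiffOn]
    exact ContMDiff.comp_contMDiffOn ha (contMDiffOn_symm_of_mem_maximalAtlas hφ₀a)
  have hF0 : F x₀ = 0 := by simp only [F, hx₀, φ₀.left_inv hp₀, hp]
  have hFd := ((hF.contDiffAt (φ₀.open_target.mem_nhds hx₀t)).differentiableAt
    (by simp)).hasFDerivAt
  set L := fderiv ℝ F x₀ with hL
  have hLv := dir_eq_of_eventuallyEq_comp (X := X) (a := a) hφ₀a hp₀ hFd (by
    filter_upwards [φ₀.open_source.mem_nhds hp₀] with x hx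
    simp only [F, φ₀.left_inv hx])
  rw [hLv] at hXa
  obtain ⟨w, hw⟩ : ∃ w : 𝔼, L w = 1 :=
    ⟨(L (mfderiv (𝓡 d) (𝓡 d) φ₀ p (X p)))⁻¹ • mfderiv (𝓡 d) (𝓡 d) φ₀ p (X p),
      (map_smul L _ _).trans (inv_mul_cancel₀ hXa)⟩
  -- The correction along `w`, with `L w = 1`, makes `L ∘ G = F` while keeping the derivative at
  -- `x₀` equal to the identity; the zero set of `F` becomes `ker L`.
  let G : 𝔼 → 𝔼 := fun x => (x - x₀) + (F x - L (x - x₀)) • w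
  have hLG : ∀ x, L (G x) = F x := fun x => by
    simp only [G, map_add, map_smul, hw, smul_eq_mul]; ring
  have hG : ContDiffOn ℝ ∞ G φ₀.target :=
    (contDiff_id.sub contDiff_const).contDiffOn.add
      ((hF.sub (L.contDiff.comp (contDiff_id.sub contDiff_const)).contDiffOn).smul
        contDiffOn_const)
  have hGd : HasFDerivAt G ((ContinuousLinearEquiv.refl ℝ 𝔼 : 𝔼 ≃L[ℝ] 𝔼) : 𝔼 →L[ℝ] 𝔼) x₀ := by
    have h1 : HasFDerivAt (fun x : 𝔼 => x - x₀) (ContinuousLinearMap.id ℝ 𝔼) x₀ :=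
      (hasFDerivAt_id x₀).sub_const x₀
    have h2 := h1.add ((hFd.sub (L.hasFDerivAt.comp x₀ h1)).smul_const w)
    refine h2.congr_fderiv ?_
    ext v
    simp
  have hG0 : G x₀ = 0 := by simp [G, hF0]
  have hs : IsOpen (φ₀.target ∩ φ₀.symm ⁻¹' O) := φ₀.isOpen_inter_preimage_symm hO
  obtain ⟨Φ, hxΦ, hΦs, hΦG, hΦi⟩ := exists_openPartialHomeomorph_contDiffOn hs
    (show x₀ ∈ φ₀.target ∩ φ₀.symm ⁻¹' O from ⟨hx₀t, by
      rw [mem_preimage, hx₀, φ₀.left_inv hp₀]; exact hpO⟩)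
    (hG.mono inter_subset_left) hGd
  have h0t : (0 : 𝔼) ∈ Φ.target := by
    have := Φ.map_source hxΦ
    rwa [hΦG, hG0] at this
  obtain ⟨r, hr, hball⟩ := Metric.isOpen_iff.mp Φ.open_target 0 h0t
  -- Cutting the image down to a ball makes the slice convex, hence the zero set in the chart domain
  -- connected.
  let φ : OpenPartialHomeomorph N 𝔼 :=
    (φ₀.trans Φ).trans (OpenPartialHomeomorph.ofSet (ball 0 r) isOpen_ball)
  have hφv : ∀ q, φ q = G (φ₀ q) := fun q => hΦG _
  have hφs : ∀ q, q ∈ φ.source ↔ q ∈ φ₀.source ∧ φ₀ q ∈ Φ.source ∧ φ q ∈ ball (0 : 𝔼) r := by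
    intro q
    simp [φ, and_assoc]
  have hφt : ∀ x ∈ ball (0 : 𝔼) r, x ∈ φ.target := fun x hx => by
    have h1 := Φ.map_target (hball hx)
    simp only [φ, OpenPartialHomeomorph.trans_target, OpenPartialHomeomorph.ofSet_target,
      OpenPartialHomeomorph.ofSet_symm, OpenPartialHomeomorph.ofSet_apply, mem_inter_iff,
      mem_preimage, id]
    exact ⟨hx, hball hx, (hΦs h1).1⟩
  have hφt' : φ.target ⊆ Φ.target ∩ Φ.symm ⁻¹' φ₀.target := by
    intro x hx
    simp only [φ, OpenPartialHomeomorph.trans_target, OpenPartialHomeomorph.ofSet_target,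
      OpenPartialHomeomorph.ofSet_symm, OpenPartialHomeomorph.ofSet_apply, mem_inter_iff,
      mem_preimage, id] at hx
    exact hx.2
  have hφ : φ ∈ IsManifold.maximalAtlas (𝓡 d) ∞ N := by
    refine φ.mem_maximalAtlas_of_contMDiffOn ?_ ?_
    · have h1 := (contMDiffOn_iff_contDiffOn.mpr hG).comp
        (contMDiffOn_of_mem_maximalAtlas hφ₀a) fun x hx => φ₀.map_source hx
      exact (h1.mono fun q hq => ((hφs q).mp hq).1).congr fun q _ => hφv q
    · exact ((contMDiffOn_symm_of_mem_maximalAtlas hφ₀a).comp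
        ((contMDiffOn_iff_contDiffOn.mpr hΦi).mono (hφt'.trans inter_subset_left))
          fun x hx => (hφt' hx).2)
  have hLφ : ∀ q ∈ φ.source, a q = L (φ q) := fun q hq => by
    rw [hφv, hLG]
    simp only [F, φ₀.left_inv ((hφs q).mp hq).1]
  have hL0 : L.toLinearMap ≠ 0 := fun h => by
    have h1 : L.toLinearMap w = 0 := by rw [h]; rfl
    exact one_ne_zero (hw.symm.trans h1)
  have hpφ : p ∈ φ.source :=
    (hφs p).mpr ⟨hp₀, hxΦ, by rw [hφv, hG0]; exact mem_ball_self hr⟩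
  have hmem : ∀ q ∈ φ.source, a q = 0 ↔ φ q ∈ LinearMap.ker L.toLinearMap := fun q hq => by
    rw [hLφ q hq]; rfl
  refine ⟨φ, hφ, hpφ, fun q hq => ?_, LinearMap.ker L.toLinearMap, ?_, hmem, fun q hq hd h => ?_,
    ⟨p, hp, hpφ⟩, ?_⟩
  · have := (hΦs ((hφs q).mp hq).2.1).2
    rwa [mem_preimage, φ₀.left_inv ((hφs q).mp hq).1] at this
  · have := Module.Dual.finrank_ker_add_one_of_ne_zero (f := L.toLinearMap) hL0
    rwa [finrank_euclideanSpace_fin] at this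
  · rw [dir_eq_of_eventuallyEq_comp (X := X) hφ hq L.hasFDerivAt
      (Filter.eventually_of_mem (φ.open_source.mem_nhds hq) hLφ)] at hd
    exact hd h
  · have h1 : {q | a q = 0} ∩ φ.source =
        φ.symm '' ((LinearMap.ker L.toLinearMap : Set 𝔼) ∩ ball 0 r) := by
      ext q
      constructor
      · rintro ⟨hq0, hq⟩
        exact ⟨φ q, ⟨(hmem q hq).mp hq0, ((hφs q).mp hq).2.2⟩, φ.left_inv hq⟩
      · rintro ⟨x, ⟨hxL, hxb⟩, rfl⟩
        have hxt := hφt x hxb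
        refine ⟨(hmem _ (φ.map_target hxt)).mpr ?_, φ.map_target hxt⟩
        rwa [φ.right_inv hxt]
    rw [h1]
    exact ((LinearMap.ker L.toLinearMap).convex.inter (convex_ball 0 r)).isPreconnected.image _
      (φ.continuousOn_symm.mono fun x hx => hφt x hx.2)

end AdaptedChart

end NullHorizon

namespace NullHorizon

open Set Metric Bundle

set_option linter.unusedSectionVars false

/-! ### Transverse zero sets and the gauge `κ_n = 0` -/

section FixedSet

variable {d : ℕ} {N : Type*} [TopologicalSpace N] [ChartedSpace (EuclideanSpace ℝ (Fin d)) N]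
  [IsManifold (𝓡 d) ∞ N]

/-- A subset of the zero set of a function increasing or decreasing along `n` is a transverse
submanifold as soon as it contains the small connected pieces of the zero set that meet it. -/
theorem NullMetricData.isTransverseSubmanifold_of_dir_ne_zero {D : NullMetricData d N}
    {a : N → ℝ} (ha : IsSmoothFun (d := d) a) {T : Set N} (hT : ∀ p ∈ T, a p = 0)
    (hd : ∀ p ∈ T, dir D.n a p ≠ 0)
    (hloc : ∀ p ∈ T, ∃ O : Set N, IsOpen O ∧ p ∈ O ∧
      ∀ C : Set N, IsConnected C → p ∈ C → C ⊆ {q | a q = 0} ∩ O → C ⊆ T) :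
    D.IsTransverseSubmanifold T := by
  intro p hp
  obtain ⟨O, hO, hpO, hC⟩ := hloc p hp
  obtain ⟨φ, hφ, hpφ, hφO, H, hH, hmem, htr, hconn⟩ :=
    exists_adapted_chart (X := D.n) ha (hT p hp) (hd p hp) hO hpO
  refine ⟨φ, hφ, hpφ, H, hH, fun q hq => ?_, htr p hpφ (hd p hp)⟩
  rw [← hmem q hq]
  exact ⟨hT q, fun h => hC _ hconn ⟨hT p hp, hpφ⟩ (inter_subset_inter_right _ hφO) ⟨h, hq⟩⟩

theorem NullMetricData.self_mem_generator (D : NullMetricData d N) (p : N) : p ∈ D.generator p :=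
  ⟨0, flowsTo_zero D.isSmoothField_n p⟩

theorem NullMetricData.eq_of_mem_generator {D : NullMetricData d N} {f : N → ℝ}
    (hf : IsSmoothFun (d := d) f) (hf0 : ∀ p, dir D.n f p = 0) {p q : N}
    (hq : q ∈ D.generator p) : f q = f p :=
  hq.choose_spec.eq_of_dir_eq_zero hf hf0

theorem dir_exp {X : VField d N} (hX : IsSmoothField X) {u : N → ℝ}
    (hu : IsSmoothFun (d := d) u) (p : N) :
    dir X (fun q => Real.exp (u q)) p = Real.exp (u p) * dir X u p := by
  have he : IsSmoothFun (d := d) (fun q => Real.exp (u q)) :=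
    Real.contDiff_exp.contMDiff.comp hu
  obtain ⟨c, ε, hε, rfl, hc⟩ := exists_isMIntegralCurveOn_Ioo hX p
  have h0 : (0 : ℝ) ∈ Ioo (-ε) ε := ⟨by linarith, hε⟩
  exact (hasDerivAt_comp_integralCurve hc h0 (he.mdifferentiableAt _)).unique
    (hasDerivAt_comp_integralCurve hc h0 (hu.mdifferentiableAt _)).exp

variable [T2Space N]

/-- A gauge in which `κ_n` vanishes. -/
theorem NullMetricData.IsCrossSection.exists_gauge {D : NullData d N} {S : Set N}
    (hS : D.IsCrossSection S) : ∃ (z : N → ℝ) (V : VField d N) (D' : NullData d N),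
      D.IsGaugeTransform D' z V ∧ ∀ p, D'.kappaN p = 0 := by
  obtain ⟨u, hu, hdu⟩ := hS.exists_dir_n_eq (NullData.isSmoothFun_kappaN (D := D))
  have hz : IsSmoothFun (d := d) (fun q => Real.exp (u q)) := Real.contDiff_exp.contMDiff.comp hu
  have hz0 : ∀ p, Real.exp (u p) ≠ 0 := fun p => Real.exp_ne_zero _
  have G := NullData.isGaugeTransform_rescale (D := D) (hz := hz) (hz0 := hz0)
  refine ⟨_, _, _, G, fun p => ?_⟩
  rw [G.kappaN_eq, dir_exp D.isSmoothField_n hu, hdu, inv_mul_cancel_left₀ (hz0 p), sub_self,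
    mul_zero]

end FixedSet

end NullHorizon

end

/-! ### Assembly of the theorem -/

open NullHorizon in
theorem theorem8p3 {d : ℕ} {N : Type*} [TopologicalSpace N] [T2Space N]
    [SecondCountableTopology N] [ConnectedSpace N]
    [ChartedSpace (EuclideanSpace ℝ (Fin d)) N] [IsManifold (𝓡 d) ∞ N]
    (D : NullData d N) (η : VField d N) :
    -- an order-one horizon is in particular a weak order-one horizon
    (D.IsAKH1 η → D.IsAWKH1 η) ∧
    (D.IsAWKH1 η →
      -- the surface gravity is constant along the generators
      (∀ p, ∀ q ∈ D.generator p, D.kappa η q = D.kappa η p) ∧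
      ∀ S : Set N, D.IsCrossSection S →
        -- gauges with vanishing `κ_n` exist, and the following holds in each of them
        (∃ (z : N → ℝ) (V : VField d N) (D' : NullData d N),
          D.IsGaugeTransform D' z V ∧ ∀ p, D'.kappaN p = 0) ∧
        ∀ (z : N → ℝ) (V : VField d N) (D' : NullData d N),
          D.IsGaugeTransform D' z V → (∀ p, D'.kappaN p = 0) →
          (∃ lam : N → ℝ, IsSmoothFun (d := d) lam ∧ ∀ p, dir D'.n lam p = 1) ∧
          ∀ lam : N → ℝ, IsSmoothFun (d := d) lam → (∀ p, dir D'.n lam p = 1) →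
            ∃ f : N → ℝ, IsSmoothFun (d := d) f ∧ (∀ p, dir D'.n f p = 0) ∧
              (∀ p, η p = (f p + D.kappa η p * lam p) • D'.n p) ∧
              NullData.fixedSet η = {p | f p + D.kappa η p * lam p = 0} ∧
              -- item (i)
              (∀ p, D.kappa η p ≠ 0 →
                ∃ U : Set N, IsOpen U ∧ p ∈ U ∧ (∀ q ∈ U, D.kappa η q ≠ 0) ∧
                  (NullData.fixedSet η ∩ U = ∅ ∨
                    (D'.IsTransverseSubmanifold (NullData.fixedSet η ∩ U) ∧
                      IsConnected (NullData.fixedSet η ∩ U)))) ∧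
              -- item (ii)
              (∀ p, D.kappa η p = 0 →
                ((∀ q ∈ D'.generator p, η q = 0) ∨ (∀ q ∈ D'.generator p, η q ≠ 0))) ∧
              -- item (iii)
              (D.IsAKH1 η →
                ∃ S₁ S₂ : Set N, NullData.fixedSet η = S₁ ∪ S₂ ∧
                  S₁ = {p | f p = 0 ∧ D.kappa η p = 0} ∧
                  S₁ = ⋃ p ∈ S₁, D'.generator p ∧
                  D'.IsTransverseSubmanifold S₂ ∧
                  (∀ p ∈ S₂, D'.IsTransverseSubmanifold (connectedComponentIn S₂ p)) ∧
                  (∀ p ∈ S₁, D.kappa η p = 0) ∧ (∀ p ∈ S₂, D.kappa η p ≠ 0))) := by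
  refine ⟨NullData.IsAKH1.isAWKH1, fun h => ?_⟩
  have hκs : IsSmoothFun (d := d) (D.kappa η) := NullData.isSmoothFun_kappa h.smooth
  have hκo : IsOpen {p | D.kappa η p ≠ 0} :=
    isOpen_ne_fun (ContMDiff.continuous hκs) continuous_const
  refine ⟨fun p q hq => NullMetricData.eq_of_mem_generator hκs h.dir_n_kappa hq, fun S hS =>
    ⟨hS.exists_gauge, fun z V D' G hκN => ⟨?_, fun lam hlam hdlam => ?_⟩⟩⟩
  -- In the new gauge `n' = z⁻¹ n`, so `n'(λ) = 1` amounts to `n(λ) = z`.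
  · obtain ⟨u, hu, hdu⟩ := hS.exists_dir_n_eq G.z_smooth
    exact ⟨u, hu, fun p => by rw [G.dir_n, hdu, inv_mul_cancel₀ (G.z_ne p)]⟩
  set a := D'.alpha η with ha_def
  have ha : IsSmoothFun (d := d) a := NullData.isSmoothFun_alpha h.smooth
  have hdκ : ∀ p, dir D'.n (D.kappa η) p = 0 := fun p => by
    rw [G.dir_n, h.dir_n_kappa, mul_zero]
  -- Gauge invariance of `κ` together with `κ_n = 0` in this gauge; all three items rest on this
  -- equation.
  have hda : ∀ p, dir D'.n a p = D.kappa η p := fun p => by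
    rw [← G.kappa_eq h.smooth h.mem_rad, NullData.kappa_eq, hκN, mul_zero, add_zero]
  have hηa : ∀ p, η p = a p • D'.n p :=
    D'.eq_alpha_smul_n η fun p => by rw [G.gamma_eq]; exact h.mem_rad p
  have hη0 : ∀ p, η p = 0 ↔ a p = 0 := fun p => by
    rw [hηa p, smul_eq_zero, or_iff_left (D'.n_ne_zero p)]
  have hfix : NullData.fixedSet η = {p | a p = 0} := Set.ext hη0
  let f : N → ℝ := fun p => a p - D.kappa η p * lam p
  have hf : IsSmoothFun (d := d) f := ha.sub (hκs.mul hlam)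
  have hdf : ∀ p, dir D'.n f p = 0 := fun p => by
    rw [dir_sub ha (hκs.mul hlam), dir_mul hκs hlam, hda, hdκ, hdlam]; ring
  have hfa : ∀ p, f p + D.kappa η p * lam p = a p := fun p => sub_add_cancel _ _
  have hfgen : ∀ p, ∀ q ∈ D'.generator p, f q = f p := fun p q hq =>
    NullMetricData.eq_of_mem_generator hf hdf hq
  have hκgen : ∀ p, ∀ q ∈ D'.generator p, D.kappa η q = D.kappa η p := fun p q hq =>
    NullMetricData.eq_of_mem_generator hκs hdκ hq
  refine ⟨f, hf, hdf, fun p => by rw [hfa, hηa], by simp only [hfix, hfa], fun p hp => ?_,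
    fun p hp => ?_, fun _ => ⟨{p | f p = 0 ∧ D.kappa η p = 0}, {p | a p = 0 ∧ D.kappa η p ≠ 0},
      ?_, rfl, ?_, ?_, fun p hp => ?_, fun p hp => hp.2, fun p hp => hp.2⟩⟩
  · by_cases hap : a p = 0
    · obtain ⟨φ, hφ, hpφ, hφO, H, -, -, -, hconn⟩ := exists_adapted_chart (X := D'.n) ha hap
        (by rwa [hda]) hκo hp
      refine ⟨φ.source, φ.open_source, hpφ, hφO, Or.inr ?_⟩
      rw [hfix]
      refine ⟨NullMetricData.isTransverseSubmanifold_of_dir_ne_zero ha (fun q hq => hq.1)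
        (fun q hq => ?_) fun q hq => ⟨φ.source, φ.open_source, hq.2, fun C _ _ hC => hC⟩, hconn⟩
      rw [hda]
      exact hφO hq.2
    -- At a point that is not fixed, the neighbourhood is shrunk to avoid fixed points altogether.
    · refine ⟨{q | D.kappa η q ≠ 0} ∩ {q | a q ≠ 0},
        hκo.inter (isOpen_ne_fun (ContMDiff.continuous ha) continuous_const), ⟨hp, hap⟩,
        fun q hq => hq.1, Or.inl ?_⟩
      rw [hfix]
      ext q
      exact ⟨fun hq => hq.2.2 hq.1, False.elim⟩
  · have hq : ∀ q ∈ D'.generator p, η q = 0 ↔ f p = 0 := fun q hq => by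
      rw [hη0, ← hfa, hκgen p q hq, hp, zero_mul, add_zero, hfgen p q hq]
    by_cases hfp : f p = 0
    · exact Or.inl fun q hqg => (hq q hqg).mpr hfp
    · exact Or.inr fun q hqg => fun h0 => hfp ((hq q hqg).mp h0)
  · rw [hfix]
    ext p
    by_cases hκ : D.kappa η p = 0
    · simp [hκ, ← hfa p]
    · simp [hκ]
  · ext p
    simp only [Set.mem_iUnion]
    refine ⟨fun hp => ⟨p, hp, D'.self_mem_generator p⟩, ?_⟩
    rintro ⟨q, ⟨hq, hqκ⟩, hpq⟩
    exact ⟨(hfgen q p hpq).trans hq, (hκgen q p hpq).trans hqκ⟩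
  · exact NullMetricData.isTransverseSubmanifold_of_dir_ne_zero ha (fun q hq => hq.1)
      (fun q hq => by rw [hda]; exact hq.2) fun q hq => ⟨_, hκo, hq.2, fun C _ _ hC => hC⟩
  · have hsub := connectedComponentIn_subset {p | a p = 0 ∧ D.kappa η p ≠ 0} p
    refine NullMetricData.isTransverseSubmanifold_of_dir_ne_zero ha (fun q hq => (hsub hq).1)
      (fun q hq => by rw [hda]; exact (hsub hq).2) fun q hq => ⟨_, hκo, (hsub hq).2,
        fun C hCc hqC hC => ?_⟩
    -- A connected piece of the zero set through `q` on which `κ ≠ 0` lies in the component of `q`,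
    -- which is that of `p`.
    rw [connectedComponentIn_eq hq]
    exact hCc.isPreconnected.subset_connectedComponentIn hqC hC
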